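/- **Setting.** Let $Q$ be a finite-dimensional smooth manifold (Hausdorff, second countable), $\pi_Q:T^*Q\to Q$ its cotangent bundle with canonical symplectic form $\omega=\sum_i dq^i\wedge dp_i$. Let $L:TQ\to\mathbb R$ be a smooth hyperregular Lagrangian (its Legendre transformation $\mathcal FL:TQ\to T^*Q$ is a diffeomorphism), $H:T^*Q\to\mathbb R$ the associated Hamiltonian, $H(\mathcal FL(v))=\langle \mathcal FL(v),v\rangle-L(v)$, and $X_H$ its Hamiltonian vector field, $\mathbf i_{X_H}\omega=\mathbf dH$. Let $\mathcal D\subset TQ$ be a smooth, bracket-generating distribution of constant rank such that $L$ is $\mathcal D$-regular (the fibre Hessian of $L$ at points of $\mathcal D$ is non-degenerate on $\mathcal D$). Let $F:T^*Q\to T^*Q$ be a smooth fibre-preserving map (external force), $W\subset T^*Q$ a control subset and $u:T^*Q\to W$ a smooth fibre-preserving map (control law). Fix a connection on $T^*Q\to Q$; for a fibre-preserving map $B$, $\mathrm{vlift}(B)X_H(\alpha)$ is the vertical vector at $\alpha$ obtained by translating the vertical part of $TB(X_H(\alpha))\in T_{B(\alpha)}T^*Q$ along the straight line from $B(\alpha)$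 to $\alpha$ in the fibre. Put $\mathcal M=\mathcal FL(\mathcal D)$, $\mathcal F=(T\pi_Q)^{-1}(\mathcal D)$, $\mathcal K=\mathcal F\cap T\mathcal M$, and let $\omega_{\mathcal K}$ be the restriction of $\omega$ to $\mathcal K$, assumed non-degenerate. For a vector $v$ at a point of $\mathcal M$, $\tau_{\mathcal K}v\in\mathcal K$ denotes the vector with $\omega(\tau_{\mathcal K}v,\cdot)=\omega(v,\cdot)$ on $\mathcal K$. The distributional RCH system consists of the vector field $X_{\mathcal K}$ on $\mathcal M$ with values in $\mathcal K$ and $\omega(X_{\mathcal K},\cdot)=\mathbf dH$ on $\mathcal K$, and of $F_{\mathcal K}=\tau_{\mathcal K}\,\mathrm{vlift}(F)X_H$, $u_{\mathcal K}=\tau_{\mathcal K}\,\mathrm{vlift}(u)X_H$; its dynamical vector field is $\tilde X=X_{\mathcal K}+F_{\mathcal K}+u_{\mathcal K}$. Let a Lie group $G$ (Hausdorff, second countable) act smoothly, freely and properly on $Q$, and on $T^*Q$ by the cotangent lift, such that $\mathcal D,H,F,W$ are $G$-invariant. Let $\mathbf J:T^*Q\to\mathfrak g^*$ be an $\mathrm{Ad}^*$-equivariant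 momentum map, $\mu$ a regular value of $\mathbf J$, $G_\mu=\{g:\mathrm{Ad}_g^*\mu=\mu\}$, $F(\mathbf J^{-1}(\mu))\subset\mathbf J^{-1}(\mu)$, $W\cap\mathbf J^{-1}(\mu)\neq\emptyset$, and assume that $\mathcal M$ and $\mathbf J^{-1}(\mu)$ intersect cleanly with $\mathcal M\cap\mathbf J^{-1}(\mu)\ne\emptyset$. Let $i_\mu:\mathbf J^{-1}(\mu)\to T^*Q$ be the inclusion, $\pi_\mu:\mathbf J^{-1}(\mu)\to(T^*Q)_\mu=\mathbf J^{-1}(\mu)/G_\mu$ the projection (a submersion), $\omega_\mu$ the reduced symplectic form, $\pi_\mu^*\omega_\mu=i_\mu^*\omega$, and $h_\mu$ the reduced Hamiltonian, $h_\mu\circ\pi_\mu=H\circ i_\mu$. Put $\mathcal M_\mu=(\mathcal M\cap\mathbf J^{-1}(\mu))/G_\mu$, $\mathcal F_\mu=T\pi_\mu(\mathcal F\cap T\mathbf J^{-1}(\mu))$, $\mathcal K_\mu=\mathcal F_\mu\cap T\mathcal M_\mu$, and assume that the restriction $\omega_{\mathcal K_\mu}$ of $\omega_\mu$ to $\mathcal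 K_\mu$ is non-degenerate. Let $X_{\mathcal K_\mu}$ be the vector field on $\mathcal M_\mu$ with values in $\mathcal K_\mu$ and $\omega_\mu(X_{\mathcal K_\mu},\cdot)=\mathbf dh_\mu$ on $\mathcal K_\mu$. Assume that along $\mathcal M\cap\mathbf J^{-1}(\mu)$ the vector fields $F_{\mathcal K},u_{\mathcal K}$ are tangent to $\mathbf J^{-1}(\mu)$ and are pushed down by $T\pi_\mu$ to vector fields $f_{\mathcal M_\mu},u_{\mathcal M_\mu}$ on $\mathcal M_\mu$, and let $f_{\mathcal K_\mu},u_{\mathcal K_\mu}$ be their restrictions to $\mathcal K_\mu$ (with respect to $\omega_\mu$). These data form the $\mathbf J$-nonholonomic $R_p$-reduced distributional RCH system. **Theorem 5.5.** Let $\gamma:Q\to T^*Q$ be a smooth one-form with $\mathrm{Im}(\gamma)\subset\mathcal M\cap\mathbf J^{-1}(\mu)$ which is $G_\mu$-invariant ($\gamma(gq)=g\cdot\gamma(q)$ for $g\in G_\mu$), let $\bar\gamma_\mu=\pi_\mu\circ\gamma:Q\to\mathcal M_\mu$, and assume $\mathrm{Im}(T\bar\gamma_\mu)\subset\mathcal K_\mu$.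 Let $\varepsilon:T^*Q\to T^*Q$ be a smooth symplectic map which is $G_\mu$-invariant ($\varepsilon(g\cdot z)=g\cdot\varepsilon(z)$ for $g\in G_\mu$) with $\varepsilon(\mathcal M\cap\mathbf J^{-1}(\mu))\subset\mathcal M\cap\mathbf J^{-1}(\mu)$; put $\bar\varepsilon_\mu=\pi_\mu\circ\varepsilon:\mathcal M\cap\mathbf J^{-1}(\mu)\to\mathcal M_\mu$ and $\tilde X^\varepsilon=T\pi_Q\circ\tilde X\circ\varepsilon$. Then $\varepsilon$ is a solution of the Type II Hamilton–Jacobi equation $$T\gamma\circ\tilde X^\varepsilon=X_{\mathcal K}\circ\varepsilon\quad\text{on }\mathcal M\cap\mathbf J^{-1}(\mu)$$ of the distributional RCH system if and only if $\varepsilon$ and $\bar\varepsilon_\mu$ satisfy the Type II Hamilton–Jacobi equation $$T\bar\gamma_\mu\circ\tilde X^\varepsilon=X_{\mathcal K_\mu}\circ\bar\varepsilon_\mu\quad\text{on }\mathcal M\cap\mathbf J^{-1}(\mu)$$ of the $\mathbf J$-nonholonomic $R_p$-reduced distributional RCH system. (Both are equations between maps into $TT^*Q$, respectively $T((T^*Q)_\mu)$,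 so they include equality of base points.) -/

import Mathlib

open Bundle
open scoped Manifold ContDiff Topology

noncomputable section

namespace NonholonomicRCH

/-! ### The cotangent bundle and its canonical symplectic form -/

section Cotangent

variable (E : Type*) [NormedAddCommGroup E] [NormedSpace ℝ E]
  (Q : Type*) [TopologicalSpace Q] [ChartedSpace E Q] [IsManifold 𝓘(ℝ, E) ∞ Q]

/-- The cotangent bundle `T*Q` of a manifold `Q` modelled on `E`. -/
abbrev Cot : Type _ :=
  TotalSpace (E →L[ℝ] ℝ) (fun q : Q => TangentSpace 𝓘(ℝ, E) q →L[ℝ] ℝ)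

/-- The model with corners of `T*Q`. -/
abbrev cotModel : ModelWithCorners ℝ (E × (E →L[ℝ] ℝ)) (ModelProd E (E →L[ℝ] ℝ)) :=
  𝓘(ℝ, E).prod 𝓘(ℝ, E →L[ℝ] ℝ)

variable {E Q}

/-- The tangent space `T_z(T*Q)`. -/
abbrev TCot (z : Cot E Q) : Type _ := TangentSpace (cotModel E) z

/-- The bundle projection `π_Q : T*Q → Q`. -/
def cotProj (z : Cot E Q) : Q := z.proj

/-- The tangent map `T_z π_Q : T_z(T*Q) → T_{π_Q z} Q`. -/
def dProj (z : Cot E Q) : TCot z →L[ℝ] TangentSpace 𝓘(ℝ, E) z.proj :=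
  mfderiv (cotModel E) 𝓘(ℝ, E) (cotProj : Cot E Q → Q) z

/-- The canonical symplectic form `ω = ∑ dqⁱ ∧ dpᵢ` on `T*Q`.  A tangent vector of `T*Q` at `z` is
represented by its coordinates `(δq, δp)` in the canonical cotangent chart induced by the preferred
chart of `Q` at the base point of `z`. -/
def canonicalForm (z : Cot E Q) (v w : TCot z) : ℝ :=
  (show E × (E →L[ℝ] ℝ) from w).2 (show E × (E →L[ℝ] ℝ) from v).1 -
    (show E × (E →L[ℝ] ℝ) from v).2 (show E × (E →L[ℝ] ℝ) from w).1

/-- The vertical vector at `z ∈ T*_q Q` with fibre component `β ∈ T*_q Q`, i.e. the derivative of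
`t ↦ z + t β` at `t = 0`. -/
def vertical (z : Cot E Q) (β : TangentSpace 𝓘(ℝ, E) z.proj →L[ℝ] ℝ) : TCot z :=
  mfderiv 𝓘(ℝ, E →L[ℝ] ℝ) (cotModel E)
    (fun p : E →L[ℝ] ℝ => (⟨z.proj, p⟩ : Cot E Q)) z.2 β

/-- The differential of a real function on `T*Q`. -/
def dFun (H : Cot E Q → ℝ) (z : Cot E Q) : TCot z →L[ℝ] ℝ :=
  mfderiv (cotModel E) 𝓘(ℝ, ℝ) H z

/-- A one-form, as a map `Q → T*Q`. -/
def formMap (γ : ∀ q : Q, TangentSpace 𝓘(ℝ, E) q →L[ℝ] ℝ) (q : Q) : Cot E Q := ⟨q, γ q⟩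

/-- A fibre-preserving map `T*Q → T*Q`, given by its restrictions to the fibres. -/
def fiberMap
    (F : ∀ q : Q, (TangentSpace 𝓘(ℝ, E) q →L[ℝ] ℝ) → (TangentSpace 𝓘(ℝ, E) q →L[ℝ] ℝ))
    (z : Cot E Q) : Cot E Q := ⟨z.proj, F z.proj z.2⟩

/-- A smooth symplectic map of `T*Q` into itself. -/
structure IsSymplecticMap (ε : Cot E Q → Cot E Q) : Prop where
  smooth : ContMDiff (cotModel E) (cotModel E) ∞ ε
  pullback : ∀ (z : Cot E Q) (v w : TCot z),
    canonicalForm (ε z) (mfderiv (cotModel E) (cotModel E) ε z v)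
      (mfderiv (cotModel E) (cotModel E) ε z w) = canonicalForm z v w

variable (E Q) in
/-- A connection on the bundle `T*Q → Q`, given by its vertical part: a smooth family of linear maps
`T_z(T*Q) → T*_{π z}Q` (the fibre being identified with the vertical space at `z`) which restricts
to the identity on vertical vectors. -/
structure VerticalPart where
  toFun : ∀ z : Cot E Q, TCot z →L[ℝ] (TangentSpace 𝓘(ℝ, E) z.proj →L[ℝ] ℝ)
  apply_vertical : ∀ (z : Cot E Q) (β : TangentSpace 𝓘(ℝ, E) z.proj →L[ℝ] ℝ),
    toFun z (vertical z β) = β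
  smooth : ContMDiff (cotModel E).tangent (cotModel E) ∞
    (fun ρ : TangentBundle (cotModel E) (Cot E Q) => (⟨ρ.proj.proj, toFun ρ.proj ρ.2⟩ : Cot E Q))

/-- `vlift(F)X`: at `z`, take the vertical part of the vector `TF(X(z))` at `F(z)` and transport it
along the straight line from `F(z)` to `z` in the fibre. -/
def vlift (A : VerticalPart E Q)
    (F : ∀ q : Q, (TangentSpace 𝓘(ℝ, E) q →L[ℝ] ℝ) → (TangentSpace 𝓘(ℝ, E) q →L[ℝ] ℝ))
    (X : ∀ z : Cot E Q, TCot z) (z : Cot E Q) : TCot z :=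
  vertical z
    (A.toFun (fiberMap F z) (mfderiv (cotModel E) (cotModel E) (fiberMap F) z (X z)))

end Cotangent

/-! ### Submanifolds and their tangent spaces -/

section Submanifold

variable {E' : Type*} [NormedAddCommGroup E'] [NormedSpace ℝ E']
  {H' : Type*} [TopologicalSpace H'] (I' : ModelWithCorners ℝ E' H')
  {P : Type*} [TopologicalSpace P] [ChartedSpace H' P]

/-- `S` is an embedded submanifold of `P`: locally it is a regular level set. -/
def IsSubmanifold (S : Set P) : Prop :=
  ∀ x ∈ S, ∃ (c : ℕ) (f : P → EuclideanSpace ℝ (Fin c)) (U : Set P),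
    IsOpen U ∧ x ∈ U ∧ ContMDiffOn I' 𝓘(ℝ, EuclideanSpace ℝ (Fin c)) ∞ f U ∧
    (∀ y ∈ U, Function.Surjective (mfderiv I' 𝓘(ℝ, EuclideanSpace ℝ (Fin c)) f y)) ∧
    S ∩ U = {y | y ∈ U ∧ f y = 0}

/-- The tangent space at `x` of a submanifold `S` of `P`, as a subspace of `T_x P`: the space of
velocities at `x` of smooth curves in `S`. -/
def tangentTo (S : Set P) (x : P) : Submodule ℝ (TangentSpace I' x) :=
  Submodule.span ℝ {v | ∃ c : ℝ → P, ContMDiffAt 𝓘(ℝ, ℝ) I' ∞ c 0 ∧ (∀ᶠ t in 𝓝 0, c t ∈ S) ∧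
    (⟨c 0, mfderiv 𝓘(ℝ, ℝ) I' c 0 (1 : ℝ)⟩ : TangentBundle I' P) = ⟨x, v⟩}

end Submanifold

/-- `τ_K`: the vector `k ∈ K` is the restriction to `K` of the vector `v`, with respect to the
bilinear form `B`, i.e. the one-forms `B(k, ·)` and `B(v, ·)` agree on `K`. -/
def IsRestriction {V : Type*} [AddCommGroup V] [Module ℝ V] (B : V → V → ℝ) (K : Submodule ℝ V)
    (v k : V) : Prop :=
  k ∈ K ∧ ∀ w ∈ K, B k w = B v w

/-- The bilinear form `B` is non-degenerate on the subspace `K`. -/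
def IsNondegenerateOn {V : Type*} [AddCommGroup V] [Module ℝ V] (B : V → V → ℝ)
    (K : Submodule ℝ V) : Prop :=
  ∀ k ∈ K, (∀ w ∈ K, B k w = 0) → k = 0

/-! ### Nonholonomic constraints -/

section Constraint

variable {E : Type*} [NormedAddCommGroup E] [NormedSpace ℝ E]
  {Q : Type*} [TopologicalSpace Q] [ChartedSpace E Q] [IsManifold 𝓘(ℝ, E) ∞ Q]

/-- A vector field on `Q` is smooth on `U`. -/
def IsSmoothFieldOn (X : ∀ q : Q, TangentSpace 𝓘(ℝ, E) q) (U : Set Q) : Prop :=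
  ContMDiffOn 𝓘(ℝ, E) 𝓘(ℝ, E).tangent ∞ (fun q => (⟨q, X q⟩ : TangentBundle 𝓘(ℝ, E) Q)) U

/-- A smooth distribution of constant rank on `Q`, i.e. a smooth subbundle of `TQ`. -/
def IsSmoothDistribution (D : ∀ q : Q, Submodule ℝ (TangentSpace 𝓘(ℝ, E) q)) : Prop :=
  ∃ k : ℕ, ∀ q₀ : Q, ∃ (U : Set Q) (X : Fin k → ∀ q : Q, TangentSpace 𝓘(ℝ, E) q),
    IsOpen U ∧ q₀ ∈ U ∧ (∀ i, IsSmoothFieldOn (X i) U) ∧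
    ∀ q ∈ U, LinearIndependent ℝ (fun i => X i q) ∧
      Submodule.span ℝ (Set.range fun i => X i q) = D q

/-- The vector fields obtained from smooth sections of `D` by iterated Lie brackets
`[D, D], [D, [D, D]], …`. -/
inductive IsIteratedBracket (D : ∀ q : Q, Submodule ℝ (TangentSpace 𝓘(ℝ, E) q)) :
    (∀ q : Q, TangentSpace 𝓘(ℝ, E) q) → Prop
  | mem (X : ∀ q : Q, TangentSpace 𝓘(ℝ, E) q) (hX : IsSmoothFieldOn X Set.univ)
      (hD : ∀ q, X q ∈ D q) : IsIteratedBracket D X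
  | bracket (X Y : ∀ q : Q, TangentSpace 𝓘(ℝ, E) q) (hX : IsSmoothFieldOn X Set.univ)
      (hD : ∀ q, X q ∈ D q) (hY : IsIteratedBracket D Y) :
      IsIteratedBracket D (VectorField.mlieBracket 𝓘(ℝ, E) X Y)

/-- `D` is completely nonholonomic (bracket-generating). -/
def IsCompletelyNonholonomic (D : ∀ q : Q, Submodule ℝ (TangentSpace 𝓘(ℝ, E) q)) : Prop :=
  ∀ q : Q, Submodule.span ℝ {v | ∃ X, IsIteratedBracket D X ∧ X q = v} = ⊤

/-- The restriction of a Lagrangian to the tangent space at `q`. -/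
def lagrangianOn (L : TangentBundle 𝓘(ℝ, E) Q → ℝ) (q : Q) (v : E) : ℝ := L ⟨q, v⟩

/-- The Legendre transformation `FL : TQ → T*Q`, i.e. the fibre derivative of `L`. -/
def legendre (L : TangentBundle 𝓘(ℝ, E) Q → ℝ) (x : TangentBundle 𝓘(ℝ, E) Q) : Cot E Q :=
  ⟨x.proj, (fderiv ℝ (lagrangianOn L x.proj) (show E from x.2) : E →L[ℝ] ℝ)⟩

/-- The Hessian of `L` along the fibre `T_q Q`, at the point `v`. -/
def fiberHessian (L : TangentBundle 𝓘(ℝ, E) Q → ℝ) (q : Q) (v w w' : TangentSpace 𝓘(ℝ, E) q) : ℝ :=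
  fderiv ℝ (fderiv ℝ (lagrangianOn L q)) (show E from v) (show E from w) (show E from w')

/-- `L` is `D`-regular: its fibre Hessian at the points of `D` is non-degenerate on `D`. -/
def IsDRegular (L : TangentBundle 𝓘(ℝ, E) Q → ℝ)
    (D : ∀ q : Q, Submodule ℝ (TangentSpace 𝓘(ℝ, E) q)) : Prop :=
  ∀ q : Q, ∀ v ∈ D q, IsNondegenerateOn (fiberHessian L q v) (D q)

/-- `L` is hyperregular: its Legendre transformation is a diffeomorphism. -/
def IsHyperregular (L : TangentBundle 𝓘(ℝ, E) Q → ℝ) : Prop :=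
  ∃ Φ : Diffeomorph 𝓘(ℝ, E).tangent (cotModel E) (TangentBundle 𝓘(ℝ, E) Q) (Cot E Q) ∞,
    ∀ x, Φ x = legendre L x

end Constraint

/-! ### Nonholonomic RCH systems and distributional RCH systems -/

section System

variable (E : Type*) [NormedAddCommGroup E] [NormedSpace ℝ E]
  (Q : Type*) [TopologicalSpace Q] [ChartedSpace E Q] [IsManifold 𝓘(ℝ, E) ∞ Q]

/-- A nonholonomic RCH system `(T*Q, ω, D, H, F, W)` with a control law `u`, where `ω` is the
canonical symplectic form.  No regularity of the control subset `W` is needed. -/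
structure System where
  /-- the Lagrangian -/
  L : TangentBundle 𝓘(ℝ, E) Q → ℝ
  /-- the nonholonomic constraint -/
  D : ∀ q : Q, Submodule ℝ (TangentSpace 𝓘(ℝ, E) q)
  /-- the Hamiltonian -/
  H : Cot E Q → ℝ
  /-- the Hamiltonian vector field of `H` -/
  XH : ∀ z : Cot E Q, TCot z
  /-- the external force -/
  F : ∀ q : Q, (TangentSpace 𝓘(ℝ, E) q →L[ℝ] ℝ) → (TangentSpace 𝓘(ℝ, E) q →L[ℝ] ℝ)
  /-- the control subset -/
  W : Set (Cot E Q)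
  /-- the control law -/
  u : ∀ q : Q, (TangentSpace 𝓘(ℝ, E) q →L[ℝ] ℝ) → (TangentSpace 𝓘(ℝ, E) q →L[ℝ] ℝ)
  smooth_L : ContMDiff 𝓘(ℝ, E).tangent 𝓘(ℝ, ℝ) ∞ L
  hyperregular : IsHyperregular L
  distribution : IsSmoothDistribution D
  complete : IsCompletelyNonholonomic D
  regular : IsDRegular L D
  smooth_H : ContMDiff (cotModel E) 𝓘(ℝ, ℝ) ∞ H
  /-- `H(q, p) = p · q̇ - L(q, q̇)` for `p = FL(q̇)` -/
  hamiltonian_eq : ∀ x : TangentBundle 𝓘(ℝ, E) Q,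
    H (legendre L x) = (legendre L x).2 x.2 - L x
  /-- `i_{X_H} ω = dH` -/
  hamilton : ∀ (z : Cot E Q) (w : TCot z), canonicalForm z (XH z) w = dFun H z w
  smooth_F : ContMDiff (cotModel E) (cotModel E) ∞ (fiberMap F)
  smooth_u : ContMDiff (cotModel E) (cotModel E) ∞ (fiberMap u)
  u_mem : ∀ z, fiberMap u z ∈ W

variable {E Q}

namespace System

variable (S : System E Q)

/-- The constraint submanifold `M = FL(D) ⊆ T*Q`. -/
def constraintSet : Set (Cot E Q) := {z | ∃ (q : Q), ∃ v ∈ S.D q, legendre S.L ⟨q, v⟩ = z}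

/-- The distribution `𝓕 = (Tπ_Q)⁻¹(D)` on `T*Q`. -/
def distF (z : Cot E Q) : Submodule ℝ (TCot z) :=
  (S.D z.proj).comap (dProj z : TCot z →ₗ[ℝ] TangentSpace 𝓘(ℝ, E) z.proj)

/-- The distribution `𝓚 = 𝓕 ∩ TM` along `M`. -/
def distK (z : Cot E Q) : Submodule ℝ (TCot z) :=
  S.distF z ⊓ tangentTo (cotModel E) S.constraintSet z

end System

/-- The distributional RCH system `(𝓚, ω_𝓚, H_𝓚, F_𝓚, u_𝓚)` associated with a nonholonomic RCH
system.  Here `ω_𝓚` is the restriction of `ω` to `𝓚` and `dH_𝓚` is the restriction of `dH` to `𝓚`.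
The vector fields live on `M` and are written as functions on `T*Q`, whose values outside `M` are
irrelevant. -/
structure DistributionalSystem (S : System E Q) (A : VerticalPart E Q) where
  /-- the nonholonomic dynamical vector field `X_𝓚` -/
  XK : ∀ z : Cot E Q, TCot z
  /-- `F_𝓚` -/
  FK : ∀ z : Cot E Q, TCot z
  /-- `u_𝓚` -/
  uK : ∀ z : Cot E Q, TCot z
  nondegenerate : ∀ z ∈ S.constraintSet, IsNondegenerateOn (canonicalForm z) (S.distK z)
  XK_mem : ∀ z ∈ S.constraintSet, XK z ∈ S.distK z
  /-- the distributional Hamiltonian equation `i_{X_𝓚} ω_𝓚 = dH_𝓚` -/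
  XK_eq : ∀ z ∈ S.constraintSet, ∀ w ∈ S.distK z, canonicalForm z (XK z) w = dFun S.H z w
  /-- `F_𝓚 = τ_𝓚 · vlift(F) X_H` -/
  FK_eq : ∀ z ∈ S.constraintSet,
    IsRestriction (canonicalForm z) (S.distK z) (vlift A S.F S.XH z) (FK z)
  /-- `u_𝓚 = τ_𝓚 · vlift(u) X_H` -/
  uK_eq : ∀ z ∈ S.constraintSet,
    IsRestriction (canonicalForm z) (S.distK z) (vlift A S.u S.XH z) (uK z)

/-- The dynamical vector field `X̃ = X_𝓚 + F_𝓚 + u_𝓚`. -/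
def DistributionalSystem.dynamics {S : System E Q} {A : VerticalPart E Q}
    (K : DistributionalSystem S A) (z : Cot E Q) : TCot z :=
  K.XK z + K.FK z + K.uK z

/-- `X̃^ε = Tπ_Q · X̃ · ε`, with values in `TQ`. -/
def DistributionalSystem.dynamicsAlong {S : System E Q} {A : VerticalPart E Q}
    (K : DistributionalSystem S A) (ε : Cot E Q → Cot E Q) (z : Cot E Q) :
    TangentBundle 𝓘(ℝ, E) Q :=
  ⟨(ε z).proj, dProj (ε z) (K.dynamics (ε z))⟩

end System

/-! ### Symmetry, momentum map and the reduced space -/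

section Symmetry

variable {E : Type*} [NormedAddCommGroup E] [NormedSpace ℝ E]
  {Q : Type*} [TopologicalSpace Q] [ChartedSpace E Q] [IsManifold 𝓘(ℝ, E) ∞ Q]
  {EG : Type*} [NormedAddCommGroup EG] [NormedSpace ℝ EG]
  {G : Type*} [Group G] [TopologicalSpace G] [ChartedSpace EG G]
  [MulAction G Q]

/-- The cotangent lifted left action: `g · α = α ∘ (T_q g)⁻¹ ∈ T*_{gq} Q` for `α ∈ T*_q Q`. -/
def cotLift (g : G) (z : Cot E Q) : Cot E Q :=
  ⟨g • z.proj, z.2.comp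
    (ContinuousLinearMap.inverse
      (mfderiv 𝓘(ℝ, E) 𝓘(ℝ, E) (fun q : Q => g • q) z.proj))⟩

/-- The adjoint action on the Lie algebra `𝔤 = T_1 G`, whose underlying vector space is the model
space `EG`: the derivative at `1` of `h ↦ g h g⁻¹`. -/
def adjointAction (g : G) : EG →L[ℝ] EG :=
  mfderiv 𝓘(ℝ, EG) 𝓘(ℝ, EG) (fun h : G => g * h * g⁻¹) 1

/-- The infinitesimal generator at `z ∈ T*Q` of the lifted action, in the direction `ξ ∈ 𝔤`. -/
def generator (G : Type*) [Group G] [TopologicalSpace G] [ChartedSpace EG G] [MulAction G Q]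
    (ξ : EG) (z : Cot E Q) : TCot z :=
  (show E × (E →L[ℝ] ℝ) from
    mfderiv 𝓘(ℝ, EG) (cotModel E) (fun g : G => cotLift g z) 1 ξ)

/-- `J : T*Q → 𝔤*` is an `Ad*`-equivariant momentum map of the lifted `G`-action. -/
structure IsMomentumMap (G : Type*) [Group G] [TopologicalSpace G] [ChartedSpace EG G]
    [MulAction G Q] (J : Cot E Q → (EG →L[ℝ] ℝ)) : Prop where
  smooth : ContMDiff (cotModel E) 𝓘(ℝ, EG →L[ℝ] ℝ) ∞ J
  /-- the Hamiltonian vector field of `z ↦ ⟨J z, ξ⟩` is the infinitesimal generator of `ξ` -/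
  generates : ∀ (z : Cot E Q) (ξ : EG) (w : TCot z),
    canonicalForm z (generator G ξ z) w =
      (show EG →L[ℝ] ℝ from mfderiv (cotModel E) 𝓘(ℝ, EG →L[ℝ] ℝ) J z w) ξ
  /-- `J (g · z) = Ad*_{g⁻¹} (J z)` -/
  equivariant : ∀ (g : G) (z : Cot E Q), J (cotLift g z) = (J z).comp (adjointAction g⁻¹)

/-- `μ` is a regular value of `J`. -/
def IsRegularValue (J : Cot E Q → (EG →L[ℝ] ℝ)) (μ : EG →L[ℝ] ℝ) : Prop :=
  ∀ z, J z = μ → Function.Surjective (mfderiv (cotModel E) 𝓘(ℝ, EG →L[ℝ] ℝ) J z)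

/-- `g` lies in the isotropy group `G_μ` of the coadjoint action: `Ad*_g μ = μ`. -/
def InIsotropy (μ : EG →L[ℝ] ℝ) (g : G) : Prop := μ.comp (adjointAction g) = μ

/-- The level set `J⁻¹(μ)`. -/
abbrev LevelSet (J : Cot E Q → (EG →L[ℝ] ℝ)) (μ : EG →L[ℝ] ℝ) : Type _ := {z : Cot E Q // J z = μ}

/-- The reduced space `(T*Q)_μ = J⁻¹(μ)/G_μ`, with the quotient topology. -/
abbrev ReducedSpace (G : Type*) [Group G] [TopologicalSpace G] [ChartedSpace EG G]
    [MulAction G Q] (J : Cot E Q → (EG →L[ℝ] ℝ)) (μ : EG →L[ℝ] ℝ) : Type _ :=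
  Quot (fun z z' : LevelSet J μ => ∃ g : G, InIsotropy μ g ∧ cotLift g z.1 = z'.1)

/-- The projection `π_μ : J⁻¹(μ) → (T*Q)_μ`. -/
def reducedProj (G : Type*) [Group G] [TopologicalSpace G] [ChartedSpace EG G]
    [MulAction G Q] (J : Cot E Q → (EG →L[ℝ] ℝ)) (μ : EG →L[ℝ] ℝ) (z : LevelSet J μ) :
    ReducedSpace G J μ := Quot.mk _ z

/-- A nonholonomic RCH system with symmetry and momentum map
`(T*Q, G, ω, J, D, H, F, W)` which is regular point reducible at `μ`. -/
structure IsPointReducible (G : Type*) [Group G] [TopologicalSpace G] [ChartedSpace EG G]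
    [MulAction G Q] (S : System E Q) (J : Cot E Q → (EG →L[ℝ] ℝ)) (μ : EG →L[ℝ] ℝ) : Prop where
  /-- `G` acts freely on `Q` -/
  free : ∀ (g : G) (q : Q), g • q = q → g = 1
  D_invariant : ∀ (g : G) (q : Q), ∀ v ∈ S.D q,
    mfderiv 𝓘(ℝ, E) 𝓘(ℝ, E) (fun q : Q => g • q) q v ∈ S.D (g • q)
  H_invariant : ∀ (g : G) (z : Cot E Q), S.H (cotLift g z) = S.H z
  F_invariant : ∀ (g : G) (z : Cot E Q), fiberMap S.F (cotLift g z) = cotLift g (fiberMap S.F z)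
  W_invariant : ∀ (g : G), ∀ z ∈ S.W, cotLift g z ∈ S.W
  momentum : IsMomentumMap G J
  regular_value : IsRegularValue J μ
  F_level : ∀ z, J z = μ → J (fiberMap S.F z) = μ
  W_level : ∃ z ∈ S.W, J z = μ
  /-- `M ∩ J⁻¹(μ)` is non-empty -/
  nonempty : ∃ z ∈ S.constraintSet, J z = μ
  /-- `M` and `J⁻¹(μ)` intersect cleanly -/
  clean_submanifold : IsSubmanifold (cotModel E) {z | z ∈ S.constraintSet ∧ J z = μ}
  clean_tangent : ∀ z ∈ S.constraintSet, J z = μ →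
    tangentTo (cotModel E) {z | z ∈ S.constraintSet ∧ J z = μ} z =
      tangentTo (cotModel E) S.constraintSet z ⊓ tangentTo (cotModel E) {z | J z = μ} z

end Symmetry

/-! ### The reduced distributional RCH system -/

section Reduced

variable {E : Type*} [NormedAddCommGroup E] [NormedSpace ℝ E]
  {Q : Type*} [TopologicalSpace Q] [ChartedSpace E Q] [IsManifold 𝓘(ℝ, E) ∞ Q]
  {EG : Type*} [NormedAddCommGroup EG] [NormedSpace ℝ EG]
  {G : Type*} [Group G] [TopologicalSpace G] [ChartedSpace EG G]
  [MulAction G Q]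
  (S : System E Q) (J : Cot E Q → (EG →L[ℝ] ℝ)) (μ : EG →L[ℝ] ℝ)
  {ES : Type*} [NormedAddCommGroup ES] [NormedSpace ℝ ES] [ChartedSpace ES (LevelSet J μ)]
  {ER : Type*} [NormedAddCommGroup ER] [NormedSpace ℝ ER] [ChartedSpace ER (ReducedSpace G J μ)]

variable (G ES ER) in
/-- The given smooth structures on `J⁻¹(μ)` and on `(T*Q)_μ = J⁻¹(μ)/G_μ` are the standard ones:
`J⁻¹(μ)` is an embedded submanifold of `T*Q`, and `π_μ` is a submersion.  These conditions determine
both smooth structures. -/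
structure IsReducedStructure : Prop where
  embedding : Manifold.IsSmoothEmbedding 𝓘(ℝ, ES) (cotModel E) ∞
    (Subtype.val : LevelSet J μ → Cot E Q)
  submersion : Manifold.IsSubmersion 𝓘(ℝ, ES) 𝓘(ℝ, ER) ∞ (reducedProj G J μ)

variable (ES) in
/-- The tangent map `T_z i_μ` of the inclusion `i_μ : J⁻¹(μ) → T*Q`. -/
def dIncl (z : LevelSet J μ) : TangentSpace 𝓘(ℝ, ES) z →L[ℝ] TCot z.1 :=
  mfderiv 𝓘(ℝ, ES) (cotModel E) (Subtype.val : LevelSet J μ → Cot E Q) z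

variable (G ES ER) in
/-- The tangent map `T_z π_μ` of the projection `π_μ : J⁻¹(μ) → (T*Q)_μ`. -/
def dRed (z : LevelSet J μ) :
    TangentSpace 𝓘(ℝ, ES) z →L[ℝ] TangentSpace 𝓘(ℝ, ER) (reducedProj G J μ z) :=
  mfderiv 𝓘(ℝ, ES) 𝓘(ℝ, ER) (reducedProj G J μ) z

variable (G) in
/-- The reduced constraint submanifold `M_μ = (M ∩ J⁻¹(μ))/G_μ ⊆ (T*Q)_μ`. -/
def reducedConstraintSet : Set (ReducedSpace G J μ) :=
  {p | ∃ z : LevelSet J μ, z.1 ∈ S.constraintSet ∧ reducedProj G J μ z = p}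

variable (G ES ER) in
/-- The distribution `𝓕_μ = Tπ_μ · 𝓕` on `(T*Q)_μ`, spanned by the vectors `Tπ_μ(v)` with
`v ∈ 𝓕 ∩ T J⁻¹(μ)`. -/
def reducedF (p : ReducedSpace G J μ) : Submodule ℝ (TangentSpace 𝓘(ℝ, ER) p) :=
  Submodule.span ℝ {w | ∃ (z : LevelSet J μ) (v : TangentSpace 𝓘(ℝ, ES) z),
    dIncl J μ ES z v ∈ S.distF z.1 ∧
    (⟨reducedProj G J μ z, dRed G J μ ES ER z v⟩ : TangentBundle 𝓘(ℝ, ER) (ReducedSpace G J μ)) =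
      ⟨p, w⟩}

variable (G ES ER) in
/-- The distribution `𝓚_μ = 𝓕_μ ∩ T M_μ` along `M_μ`. -/
def reducedK (p : ReducedSpace G J μ) : Submodule ℝ (TangentSpace 𝓘(ℝ, ER) p) :=
  reducedF G S J μ ES ER p ⊓ tangentTo 𝓘(ℝ, ER) (reducedConstraintSet G S J μ) p

variable (G ES ER) {S} in
/-- The `J`-nonholonomic `R_p`-reduced distributional RCH system
`(𝓚_μ, ω_{𝓚_μ}, h_{𝓚_μ}, f_{𝓚_μ}, u_{𝓚_μ})`.  Here `ω_{𝓚_μ}` is the restriction of the reduced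
symplectic form `ω_μ` to `𝓚_μ` and `dh_{𝓚_μ}` is the restriction of `dh_μ` to `𝓚_μ`.  The vector
fields live on `M_μ` and are written as functions on `(T*Q)_μ`, whose values outside `M_μ` are
irrelevant. -/
structure ReducedDistributionalSystem {A : VerticalPart E Q} (K : DistributionalSystem S A) where
  /-- the reduced symplectic form `ω_μ` -/
  form : ∀ p : ReducedSpace G J μ,
    TangentSpace 𝓘(ℝ, ER) p →L[ℝ] TangentSpace 𝓘(ℝ, ER) p →L[ℝ] ℝ
  /-- the reduced Hamiltonian `h_μ` -/
  h : ReducedSpace G J μ → ℝ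
  /-- the reduced dynamical vector field `X_{𝓚_μ}` -/
  XK : ∀ p : ReducedSpace G J μ, TangentSpace 𝓘(ℝ, ER) p
  /-- the vector field `f_{M_μ}` -/
  fM : ∀ p : ReducedSpace G J μ, TangentSpace 𝓘(ℝ, ER) p
  /-- the vector field `u_{M_μ}` -/
  uM : ∀ p : ReducedSpace G J μ, TangentSpace 𝓘(ℝ, ER) p
  /-- `f_{𝓚_μ}` -/
  fK : ∀ p : ReducedSpace G J μ, TangentSpace 𝓘(ℝ, ER) p
  /-- `u_{𝓚_μ}` -/
  uK : ∀ p : ReducedSpace G J μ, TangentSpace 𝓘(ℝ, ER) p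
  /-- `π_μ^* ω_μ = i_μ^* ω` -/
  form_eq : ∀ (z : LevelSet J μ) (v w : TangentSpace 𝓘(ℝ, ES) z),
    form (reducedProj G J μ z) (dRed G J μ ES ER z v) (dRed G J μ ES ER z w) =
      canonicalForm z.1 (dIncl J μ ES z v) (dIncl J μ ES z w)
  smooth_h : ContMDiff 𝓘(ℝ, ER) 𝓘(ℝ, ℝ) ∞ h
  /-- `h_μ · π_μ = H · i_μ` -/
  h_eq : ∀ z : LevelSet J μ, h (reducedProj G J μ z) = S.H z.1
  nondegenerate : ∀ p ∈ reducedConstraintSet G S J μ,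
    IsNondegenerateOn (fun v w => form p v w) (reducedK G S J μ ES ER p)
  XK_mem : ∀ p ∈ reducedConstraintSet G S J μ, XK p ∈ reducedK G S J μ ES ER p
  /-- the reduced distributional Hamiltonian equation -/
  XK_eq : ∀ p ∈ reducedConstraintSet G S J μ, ∀ w ∈ reducedK G S J μ ES ER p,
    form p (XK p) w = mfderiv 𝓘(ℝ, ER) 𝓘(ℝ, ℝ) h p w
  /-- `F_𝓚` is pushed down to `f_{M_μ}` -/
  fM_eq : ∀ z : LevelSet J μ, z.1 ∈ S.constraintSet →
    ∃ v : TangentSpace 𝓘(ℝ, ES) z, dIncl J μ ES z v = K.FK z.1 ∧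
      dRed G J μ ES ER z v = fM (reducedProj G J μ z)
  /-- `u_𝓚` is pushed down to `u_{M_μ}` -/
  uM_eq : ∀ z : LevelSet J μ, z.1 ∈ S.constraintSet →
    ∃ v : TangentSpace 𝓘(ℝ, ES) z, dIncl J μ ES z v = K.uK z.1 ∧
      dRed G J μ ES ER z v = uM (reducedProj G J μ z)
  /-- `f_{𝓚_μ} = τ_{𝓚_μ} · f_{M_μ}` -/
  fK_eq : ∀ p ∈ reducedConstraintSet G S J μ,
    IsRestriction (fun v w => form p v w) (reducedK G S J μ ES ER p) (fM p) (fK p)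
  /-- `u_{𝓚_μ} = τ_{𝓚_μ} · u_{M_μ}` -/
  uK_eq : ∀ p ∈ reducedConstraintSet G S J μ,
    IsRestriction (fun v w => form p v w) (reducedK G S J μ ES ER p) (uM p) (uK p)

end Reduced

end NonholonomicRCH

end

set_option linter.unusedSectionVars false

/-! Everything reduces to a statement at the single point y = ε(z) of M ∩ J⁻¹(μ).

Force and control drop out of X̃^ε. Both are 𝓚-restrictions of vertical vectors. Pairing with the
vertical vectors of 𝓚, which come from the fibre Hessian of L along D, shows by D-regularity that
such a restriction is again vertical (`System.dProj_eq_zero_of_isRestriction`). Hence Tπ_Q X̃ = Tπ_Q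
X_𝓚 on M, and both equations involve v = Tπ_Q X_𝓚(y) only.

Base points: if γ(π_Q y) ≠ y, both equations fail. For the reduced one, equality of base points
would give y = g · γ(π_Q y) over the same point of Q, and freeness forces g = 1.

If y = γ(q), the two directions test against different vectors (`mfderiv_formMap_eq_XK_iff`). From
Tγ v = X_𝓚: each w in 𝓚_μ is Tπ_μ a for some a in 𝓚 tangent to J⁻¹(μ)
(`IsReducedStructure.exists_lift_reducedK`), so ω_μ(Tγ̄_μ v, w) = ω(X_𝓚, a) = dH(a) = dh_μ(w), and
ω_μ is non-degenerate on 𝓚_μ. Conversely, Tγ v and X_𝓚 lie in 𝓚 with the same projection v. Their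
difference is vertical, vertical vectors pair to zero with each other, and each vector of 𝓚 is some
Tγ w, w ∈ D, plus a vertical one. So testing against Tγ w suffices
(`DistributionalSystem.eq_of_dProj_eq`); there Im Tγ̄_μ ⊂ 𝓚_μ makes the reduced equation available.

The lifting of 𝓚_μ rests on the local form of the submersion π_μ and on the G-invariance of M =
FL(D). The latter is derived from that of D and H, the fibre derivative of H being the inverse of
FL. -/

namespace NonholonomicRCH

/-! ### Tangent vectors of T*Q in canonical coordinates. -/

section Coordinates

variable {E : Type*} [NormedAddCommGroup E] [NormedSpace ℝ E]
  {Q : Type*} [TopologicalSpace Q] [ChartedSpace E Q] [IsManifold 𝓘(ℝ, E) ∞ Q]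

/-- Over its own base point the preferred trivialization is the identity. This is what makes the
coordinates (δq, δp) of a vector at z agree literally with base and fibre data. -/
lemma inCoordinates_cotangent_self (q : Q) (p : TangentSpace 𝓘(ℝ, E) q →L[ℝ] ℝ) :
    ContinuousLinearMap.inCoordinates E (TangentSpace 𝓘(ℝ, E)) ℝ (Bundle.Trivial Q ℝ)
      q q q q p = p := by
  ext v
  simp only [ContinuousLinearMap.inCoordinates]
  simp
  rw [TangentBundle.symmL_trivializationAt_eq_core (mem_chart_source E q)]
  erw [(tangentBundleCore 𝓘(ℝ, E) Q).coordChange_self _ _ (mem_chart_source E q)]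
  rfl

lemma contMDiff_fiber (q : Q) :
    ContMDiff 𝓘(ℝ, E →L[ℝ] ℝ) (cotModel E) ∞ (fun p : E →L[ℝ] ℝ => (⟨q, p⟩ : Cot E Q)) := by
  intro p
  rw [contMDiffAt_hom_bundle]
  refine ⟨contMDiffAt_const, ?_⟩
  refine contMDiffAt_id.congr_of_eventuallyEq (Filter.Eventually.of_forall fun p' => ?_)
  exact inCoordinates_cotangent_self q p'

lemma contMDiff_cotProj : ContMDiff (cotModel E) 𝓘(ℝ, E) ∞ (cotProj : Cot E Q → Q) :=
  contMDiff_proj _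

lemma extChartAt_cot_fst (z y : Cot E Q) :
    (extChartAt (cotModel E) z y).1 = extChartAt 𝓘(ℝ, E) z.proj y.proj := by
  simp [hom_chart]

lemma dProj_apply (z : Cot E Q) (v : TCot z) :
    dProj z v = (show E × (E →L[ℝ] ℝ) from v).1 := by
  have h : HasMFDerivAt (cotModel E) 𝓘(ℝ, E) (cotProj : Cot E Q → Q) z
      (ContinuousLinearMap.fst ℝ E (E →L[ℝ] ℝ)) := by
    refine ⟨contMDiff_cotProj.continuous.continuousAt, ?_⟩
    refine (hasFDerivWithinAt_fst (p := extChartAt (cotModel E) z z)).congr_of_eventuallyEq ?_ ?_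
    · filter_upwards [extChartAt_target_mem_nhdsWithin (I := cotModel E) z] with x hx
      simp only [writtenInExtChartAt, Function.comp, cotProj]
      rw [← extChartAt_cot_fst, PartialEquiv.right_inv _ hx]
    · simp only [writtenInExtChartAt, Function.comp, cotProj]
      rw [← extChartAt_cot_fst, extChartAt_to_inv]
  rw [dProj, h.mfderiv]
  rfl

lemma vertical_eq (z : Cot E Q) (β : TangentSpace 𝓘(ℝ, E) z.proj →L[ℝ] ℝ) :
    vertical z β = (show TCot z from ((0, β) : E × (E →L[ℝ] ℝ))) := by
  have h : HasMFDerivAt 𝓘(ℝ, E →L[ℝ] ℝ) (cotModel E)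
      (fun p : E →L[ℝ] ℝ => (⟨z.proj, p⟩ : Cot E Q)) z.2
      (ContinuousLinearMap.inr ℝ E (E →L[ℝ] ℝ)) := by
    refine ⟨(contMDiff_fiber z.proj).continuous.continuousAt, ?_⟩
    refine HasFDerivWithinAt.congr_of_eventuallyEq (f := fun p : E →L[ℝ] ℝ => ((extChartAt 𝓘(ℝ, E) z.proj z.proj, p) : E × (E →L[ℝ] ℝ))) ?_ ?_ ?_
    · exact (hasFDerivAt_prodMk_right _ _).hasFDerivWithinAt
    · refine Filter.Eventually.of_forall fun p => ?_
      simp only [writtenInExtChartAt, Function.comp]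
      simp [hom_chart]
      exact inCoordinates_cotangent_self _ _
    · simp only [writtenInExtChartAt, Function.comp]
      simp [hom_chart]
      exact inCoordinates_cotangent_self _ _
  rw [vertical, h.mfderiv]
  rfl

lemma dProj_add (z : Cot E Q) (v w : TCot z) : dProj z (v + w) = dProj z v + dProj z w := by
  rw [dProj_apply, dProj_apply, dProj_apply]; rfl

lemma dProj_sub (z : Cot E Q) (v w : TCot z) : dProj z (v - w) = dProj z v - dProj z w := by
  rw [dProj_apply, dProj_apply, dProj_apply]; rfl

lemma dProj_vertical (z : Cot E Q) (β : TangentSpace 𝓘(ℝ, E) z.proj →L[ℝ] ℝ) :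
    dProj z (vertical z β) = 0 := by
  rw [dProj_apply, vertical_eq]; rfl

lemma canonicalForm_vertical_right (z : Cot E Q) (v : TCot z)
    (β : TangentSpace 𝓘(ℝ, E) z.proj →L[ℝ] ℝ) :
    canonicalForm z v (vertical z β) = β (dProj z v) := by
  rw [dProj_apply, vertical_eq, canonicalForm]
  exact (congrArg (β _ - ·) (map_zero (show E × (E →L[ℝ] ℝ) from v).2)).trans (sub_zero _)

/-- The fibres of T*Q are isotropic: each term of ω contains a factor δq. -/
lemma canonicalForm_eq_zero_of_dProj {z : Cot E Q} {v w : TCot z} (hv : dProj z v = 0)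
    (hw : dProj z w = 0) : canonicalForm z v w = 0 := by
  rw [dProj_apply] at hv hw
  rw [canonicalForm, hv, hw]
  exact (congrArg₂ (· - ·) (map_zero (show E × (E →L[ℝ] ℝ) from w).2)
    (map_zero (show E × (E →L[ℝ] ℝ) from v).2)).trans (sub_zero _)

lemma canonicalForm_sub_left (z : Cot E Q) (v v' w : TCot z) :
    canonicalForm z (v - v') w = canonicalForm z v w - canonicalForm z v' w := by
  have h : ∀ a a' b : E × (E →L[ℝ] ℝ), b.2 (a - a').1 - (a - a').2 b.1 =
      (b.2 a.1 - a.2 b.1) - (b.2 a'.1 - a'.2 b.1) := by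
    intro a a' b
    simp only [Prod.fst_sub, Prod.snd_sub, map_sub, sub_apply]
    ring
  exact h v v' w

lemma canonicalForm_add_right (z : Cot E Q) (v w w' : TCot z) :
    canonicalForm z v (w + w') = canonicalForm z v w + canonicalForm z v w' := by
  have h : ∀ a b b' : E × (E →L[ℝ] ℝ), (b + b').2 a.1 - a.2 (b + b').1 =
      (b.2 a.1 - a.2 b.1) + (b'.2 a.1 - a.2 b'.1) := by
    intro a b b'
    simp only [Prod.fst_add, Prod.snd_add, map_add, add_apply]
    ring
  exact h v w w'

end Coordinates

/-! ### Tangent spaces of subsets, described by velocities of curves. -/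

section TangentTo

variable {E' : Type*} [NormedAddCommGroup E'] [NormedSpace ℝ E']
  {H' : Type*} [TopologicalSpace H'] {I' : ModelWithCorners ℝ E' H'}
  {P : Type*} [TopologicalSpace P] [ChartedSpace H' P]
  {E'' : Type*} [NormedAddCommGroup E''] [NormedSpace ℝ E'']
  {H'' : Type*} [TopologicalSpace H''] {I'' : ModelWithCorners ℝ E'' H''}
  {P' : Type*} [TopologicalSpace P'] [ChartedSpace H'' P']

lemma mem_tangentTo_of_curve {S : Set P} {c : ℝ → P} (hc : ContMDiffAt 𝓘(ℝ, ℝ) I' ∞ c 0)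
    (hS : ∀ᶠ t in 𝓝 0, c t ∈ S) :
    (mfderiv 𝓘(ℝ, ℝ) I' c 0 (1 : ℝ) : TangentSpace I' (c 0)) ∈ tangentTo I' S (c 0) :=
  Submodule.subset_span ⟨c, hc, hS, rfl⟩

/-- To check that a subspace of `T_x P` contains the tangent space of `S`, it suffices to look at
the velocities of curves in `S` passing through `x`. -/
lemma tangentTo_le {S : Set P} {x : P} {N : Submodule ℝ (TangentSpace I' x)}
    (h : ∀ c : ℝ → P, ContMDiffAt 𝓘(ℝ, ℝ) I' ∞ c 0 → (∀ᶠ t in 𝓝 0, c t ∈ S) → c 0 = x →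
      ∀ c' : ℝ →L[ℝ] E', HasMFDerivAt 𝓘(ℝ, ℝ) I' c 0 c' →
        (show TangentSpace I' x from c' 1) ∈ N) :
    tangentTo I' S x ≤ N := by
  refine Submodule.span_le.2 ?_
  rintro v ⟨c, hc, hS, hv⟩
  obtain ⟨h1, h2⟩ := TotalSpace.mk.inj hv
  have h4 : (show TangentSpace I' x from mfderiv 𝓘(ℝ, ℝ) I' c 0 (1 : ℝ)) = v := eq_of_heq h2
  rw [← h4]
  exact h c hc hS h1 _ (hc.mdifferentiableAt (by simp)).hasMFDerivAt

lemma mem_tangentTo_of_hasMFDerivAt {S : Set P} {c : ℝ → P} {x : P}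
    (hc : ContMDiffAt 𝓘(ℝ, ℝ) I' ∞ c 0)
    (hS : ∀ᶠ t in 𝓝 0, c t ∈ S) (hx : c 0 = x) {c' : ℝ →L[ℝ] E'}
    (h : HasMFDerivAt 𝓘(ℝ, ℝ) I' c 0 c') :
    (show TangentSpace I' x from c' 1) ∈ tangentTo I' S x := by
  subst hx
  have := mem_tangentTo_of_curve hc hS
  rwa [h.mfderiv] at this

/-- The tangent map of `f` sends the tangent space of `S` to that of `T` if `f` maps `S` to `T`. -/
lemma mfderiv_mem_tangentTo {f : P → P'} {x : P} (hf : ContMDiffAt I' I'' ∞ f x) {S : Set P}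
    {T : Set P'} (hST : ∀ y ∈ S, f y ∈ T) {v : TangentSpace I' x} (hv : v ∈ tangentTo I' S x) :
    mfderiv I' I'' f x v ∈ tangentTo I'' T (f x) := by
  suffices tangentTo I' S x ≤ (tangentTo I'' T (f x)).comap
      (mfderiv I' I'' f x : TangentSpace I' x →ₗ[ℝ] TangentSpace I'' (f x)) from this hv
  refine tangentTo_le fun c hc hS hx c' hc' => ?_
  subst hx
  exact mem_tangentTo_of_hasMFDerivAt (hf.comp 0 hc) (hS.mono fun t ht => hST _ ht) rfl
    ((hf.mdifferentiableAt (by simp)).hasMFDerivAt.comp 0 hc')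

end TangentTo

/-! ### Tangent vectors as velocities of straight lines in a chart. -/

section Charts

variable {E' : Type*} [NormedAddCommGroup E'] [NormedSpace ℝ E']
  {P : Type*} [TopologicalSpace P] [ChartedSpace E' P] [IsManifold 𝓘(ℝ, E') ∞ P]

/-- In a chart `φ` around `x`, every tangent vector at `x` is the velocity of a straight line. -/
lemma exists_line_velocity {φ : OpenPartialHomeomorph P E'}
    (hφ : φ ∈ IsManifold.maximalAtlas 𝓘(ℝ, E') ∞ P) {x : P} (hx : x ∈ φ.source)
    (v : TangentSpace 𝓘(ℝ, E') x) :
    ∃ (v' : E') (c' : ℝ →L[ℝ] E'), v' = mfderiv 𝓘(ℝ, E') 𝓘(ℝ, E') φ x v ∧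
      ContMDiffAt 𝓘(ℝ, ℝ) 𝓘(ℝ, E') ∞ (fun t : ℝ => φ.symm (φ x + t • v')) 0 ∧
      HasMFDerivAt 𝓘(ℝ, ℝ) 𝓘(ℝ, E') (fun t : ℝ => φ.symm (φ x + t • v')) 0 c' ∧ c' 1 = v := by
  set v' : E' := mfderiv 𝓘(ℝ, E') 𝓘(ℝ, E') φ x v with hv'
  have hl : HasMFDerivAt 𝓘(ℝ, ℝ) 𝓘(ℝ, E') (fun t : ℝ => φ x + t • v') 0
      (ContinuousLinearMap.toSpanSingleton ℝ v') := by
    refine HasFDerivAt.hasMFDerivAt ?_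
    have := ((hasDerivAt_id (0 : ℝ)).smul_const v').const_add (φ x)
    exact (by simpa only [id, one_smul] using this : HasDerivAt _ v' (0 : ℝ)).hasFDerivAt
  have hls : ContMDiffAt 𝓘(ℝ, ℝ) 𝓘(ℝ, E') ∞ (fun t : ℝ => φ x + t • v') 0 := by
    refine ContDiffAt.contMDiffAt ?_
    fun_prop
  have h0 : φ x + (0 : ℝ) • v' = φ x := by simp
  have hs : ContMDiffAt 𝓘(ℝ, E') 𝓘(ℝ, E') ∞ φ.symm (φ x) :=
    contMDiffAt_symm_of_mem_maximalAtlas hφ (φ.map_source hx)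
  have hs' := (hs.mdifferentiableAt (by simp)).hasMFDerivAt
  have hφ' := ((contMDiffAt_of_mem_maximalAtlas hφ hx).mdifferentiableAt (by simp)).hasMFDerivAt
  have hinv : (mfderiv 𝓘(ℝ, E') 𝓘(ℝ, E') φ.symm (φ x)).comp
      (mfderiv 𝓘(ℝ, E') 𝓘(ℝ, E') φ x) = ContinuousLinearMap.id ℝ E' := by
    have h1 := hs'.comp x hφ'
    have h2 : HasMFDerivAt 𝓘(ℝ, E') 𝓘(ℝ, E') (φ.symm ∘ φ) x (ContinuousLinearMap.id ℝ E') :=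
      (hasMFDerivAt_id x).congr_of_eventuallyEq <| by
        filter_upwards [φ.open_source.mem_nhds hx] with y hy using φ.left_inv hy
    exact hasMFDerivAt_unique h1 h2
  rw [← h0] at hs
  have hs'' : HasMFDerivAt 𝓘(ℝ, E') 𝓘(ℝ, E') φ.symm (φ x + (0 : ℝ) • v')
      (show E' →L[ℝ] E' from mfderiv 𝓘(ℝ, E') 𝓘(ℝ, E') φ.symm (φ x)) := by
    rw [h0]; exact hs'
  refine ⟨v', _, rfl, hs.comp (0 : ℝ) hls, hs''.comp (0 : ℝ) hl, ?_⟩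
  exact (congrArg (mfderiv 𝓘(ℝ, E') 𝓘(ℝ, E') φ.symm (φ x)) (one_smul ℝ v')).trans
    (DFunLike.congr_fun hinv v)

lemma tangentTo_univ (x : P) : tangentTo 𝓘(ℝ, E') (Set.univ : Set P) x = ⊤ := by
  refine eq_top_iff.2 fun v _ => ?_
  obtain ⟨v', c', -, h1, h2, rfl⟩ := exists_line_velocity
    (IsManifold.chart_mem_maximalAtlas (I := 𝓘(ℝ, E')) (n := ∞) x) (mem_chart_source E' x) v
  exact mem_tangentTo_of_hasMFDerivAt (S := Set.univ) h1 (by simp) (x := x)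
    (by simp) h2

end Charts

/-! ### Submersions: local sections, kernels, preimages of tangent spaces. -/

section Submersion

variable {E' : Type*} [NormedAddCommGroup E'] [NormedSpace ℝ E']
  {P : Type*} [TopologicalSpace P] [ChartedSpace E' P] [IsManifold 𝓘(ℝ, E') ∞ P]
  {E'' : Type*} [NormedAddCommGroup E''] [NormedSpace ℝ E'']
  {N : Type*} [TopologicalSpace N] [ChartedSpace E'' N] [IsManifold 𝓘(ℝ, E'') ∞ N]
  {f : P → N}

/-- In suitable charts f is a linear projection; a section is obtained by freezing the complementary
coordinate at its value at x. -/
lemma exists_local_section {x : P} (hf : Manifold.IsSubmersionAt 𝓘(ℝ, E') 𝓘(ℝ, E'') ∞ f x) :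
    ∃ σ : N → P, ContMDiffAt 𝓘(ℝ, E'') 𝓘(ℝ, E') ∞ σ (f x) ∧ σ (f x) = x ∧
      ∀ᶠ p in 𝓝 (f x), f (σ p) = p := by
  have hw : ∀ u ∈ hf.domChart.target, hf.codChart (f (hf.domChart.symm u)) = (hf.equiv u).1 := by
    intro u hu
    have hu' : u ∈ (hf.domChart.extend 𝓘(ℝ, E')).target := by simpa using hu
    simpa using hf.writtenInCharts hu'
  have hx := hf.mem_domChart_source
  have hfx := hf.mem_codChart_source
  have hw0 := hw _ (hf.domChart.map_source hx)
  rw [hf.domChart.left_inv hx] at hw0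
  set l : N → E' := fun p => hf.equiv.symm (hf.codChart p, (hf.equiv (hf.domChart x)).2) with hl
  have hl0 : l (f x) = hf.domChart x := by
    rw [hl]; simp only; rw [hw0]; simp
  have hls : ContMDiffAt 𝓘(ℝ, E'') 𝓘(ℝ, E') ∞ l (f x) := by
    have h1 := contMDiffAt_of_mem_maximalAtlas hf.codChart_mem_maximalAtlas hfx
    have h2 : ContMDiff 𝓘(ℝ, E'') 𝓘(ℝ, E') ∞
        (fun b : E'' => hf.equiv.symm (b, (hf.equiv (hf.domChart x)).2)) := by
      refine ContDiff.contMDiff ?_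
      fun_prop
    exact h2.contMDiffAt.comp (f x) h1
  refine ⟨fun p => hf.domChart.symm (l p), ?_, ?_, ?_⟩
  · refine ContMDiffAt.comp (f x) (I' := 𝓘(ℝ, E')) ?_ hls
    rw [hl0]
    exact contMDiffAt_symm_of_mem_maximalAtlas hf.domChart_mem_maximalAtlas
      (hf.domChart.map_source hx)
  · simp only [hl0]; exact hf.domChart.left_inv hx
  · have h1 : ∀ᶠ p in 𝓝 (f x), l p ∈ hf.domChart.target := by
      refine hls.continuousAt.eventually_mem (hf.domChart.open_target.mem_nhds ?_)
      rw [hl0]; exact hf.domChart.map_source hx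
    filter_upwards [h1, hf.codChart.open_source.mem_nhds hfx] with p hp hp'
    refine hf.codChart.injOn (hf.source_subset_preimage_source (hf.domChart.map_target hp)) hp' ?_
    rw [hw _ hp]
    simp [hl]

/-- The straight line with velocity v in the adapted chart has constant projected coordinate when v
is in the kernel, hence stays in the fibre. -/
lemma mem_tangentTo_fiber {x : P} (hf : Manifold.IsSubmersionAt 𝓘(ℝ, E') 𝓘(ℝ, E'') ∞ f x)
    {v : TangentSpace 𝓘(ℝ, E') x} (hv : mfderiv 𝓘(ℝ, E') 𝓘(ℝ, E'') f x v = 0) :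
    v ∈ tangentTo 𝓘(ℝ, E') (f ⁻¹' {f x}) x := by
  have hw : ∀ u ∈ hf.domChart.target, hf.codChart (f (hf.domChart.symm u)) = (hf.equiv u).1 := by
    intro u hu
    have hu' : u ∈ (hf.domChart.extend 𝓘(ℝ, E')).target := by simpa using hu
    simpa using hf.writtenInCharts hu'
  have hx := hf.mem_domChart_source
  have hfx := hf.mem_codChart_source
  obtain ⟨v', c', hv', h1, h2, rfl⟩ := exists_line_velocity hf.domChart_mem_maximalAtlas hx v
  have hkey : (hf.equiv v').1 = 0 := by
    have hφ := ((contMDiffAt_of_mem_maximalAtlas hf.domChart_mem_maximalAtlas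
      hx).mdifferentiableAt (by simp)).hasMFDerivAt
    have hψ := ((contMDiffAt_of_mem_maximalAtlas hf.codChart_mem_maximalAtlas
      hfx).mdifferentiableAt (by simp)).hasMFDerivAt
    have hf' := (hf.contMDiffAt.mdifferentiableAt (by simp)).hasMFDerivAt
    have hA := hψ.comp x hf'
    have hB : HasMFDerivAt 𝓘(ℝ, E') 𝓘(ℝ, E'') ((fun u => (hf.equiv u).1) ∘ hf.domChart) x _ :=
      HasMFDerivAt.comp x (HasFDerivAt.hasMFDerivAt
        ((ContinuousLinearMap.fst ℝ E'' _ ∘L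
          (hf.equiv : E' →L[ℝ] E'' × hf.complement)).hasFDerivAt)) hφ
    have hAB : HasMFDerivAt 𝓘(ℝ, E') 𝓘(ℝ, E'') ((fun u => (hf.equiv u).1) ∘ hf.domChart) x _ :=
      hA.congr_of_eventuallyEq <| by
        filter_upwards [hf.domChart.open_source.mem_nhds hx] with y hy
        simp only [Function.comp]
        rw [← hw _ (hf.domChart.map_source hy), hf.domChart.left_inv hy]
    have := DFunLike.congr_fun (hasMFDerivAt_unique hB hAB) (c' 1)
    rw [hv']
    refine this.trans ((congrArg (mfderiv 𝓘(ℝ, E'') 𝓘(ℝ, E'') hf.codChart (f x)) hv).trans ?_)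
    exact map_zero (mfderiv 𝓘(ℝ, E'') 𝓘(ℝ, E'') hf.codChart (f x))
  refine mem_tangentTo_of_hasMFDerivAt h1 ?_ (by simp [hf.domChart.left_inv hx]) h2
  have hc : ∀ᶠ t : ℝ in 𝓝 0, hf.domChart x + t • v' ∈ hf.domChart.target := by
    have : ContinuousAt (fun t : ℝ => hf.domChart x + t • v') 0 := by fun_prop
    refine this.eventually_mem (hf.domChart.open_target.mem_nhds ?_)
    simpa using hf.domChart.map_source hx
  filter_upwards [hc] with t ht
  refine hf.codChart.injOn (hf.source_subset_preimage_source (hf.domChart.map_target ht)) hfx ?_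
  rw [hw _ ht]
  have := hw _ (hf.domChart.map_source hx)
  rw [hf.domChart.left_inv hx] at this
  simp [this, hkey]

lemma mfderiv_comp_section {x : P} (hf : ContMDiff 𝓘(ℝ, E') 𝓘(ℝ, E'') ∞ f) {σ : N → P}
    (hσ : ContMDiffAt 𝓘(ℝ, E'') 𝓘(ℝ, E') ∞ σ (f x)) (hx : σ (f x) = x)
    (h : ∀ᶠ p in 𝓝 (f x), f (σ p) = p) (w : TangentSpace 𝓘(ℝ, E'') (f x)) :
    mfderiv 𝓘(ℝ, E') 𝓘(ℝ, E'') f x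
      (show E' from mfderiv 𝓘(ℝ, E'') 𝓘(ℝ, E') σ (f x) w) = w := by
  have h1 : HasMFDerivAt 𝓘(ℝ, E') 𝓘(ℝ, E'') f (σ (f x))
      (show E' →L[ℝ] E'' from mfderiv 𝓘(ℝ, E') 𝓘(ℝ, E'') f x) := by
    rw [hx]; exact ((hf x).mdifferentiableAt (by simp)).hasMFDerivAt
  have h2 := h1.comp (f x) (hσ.mdifferentiableAt (by simp)).hasMFDerivAt
  have h3 : HasMFDerivAt 𝓘(ℝ, E'') 𝓘(ℝ, E'') (f ∘ σ) (f x) (ContinuousLinearMap.id ℝ E'') :=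
    (hasMFDerivAt_id (f x)).congr_of_eventuallyEq h
  exact DFunLike.congr_fun (hasMFDerivAt_unique h2 h3) w

/-- A local section through x lifts the image of v to a vector b tangent to the preimage; v - b is
in the kernel, hence tangent to the fibre, which lies in the preimage. No regularity of T is needed.
-/
lemma tangentTo_preimage {x : P} (hf : Manifold.IsSubmersion 𝓘(ℝ, E') 𝓘(ℝ, E'') ∞ f)
    {T : Set N} (hx : f x ∈ T) {v : TangentSpace 𝓘(ℝ, E') x}
    (hv : mfderiv 𝓘(ℝ, E') 𝓘(ℝ, E'') f x v ∈ tangentTo 𝓘(ℝ, E'') T (f x)) :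
    v ∈ tangentTo 𝓘(ℝ, E') (f ⁻¹' T) x := by
  obtain ⟨σ, hσ, hσx, hfσ⟩ := exists_local_section (hf.isSubmersionAt x)
  have hle : tangentTo 𝓘(ℝ, E'') T (f x) ≤ (tangentTo 𝓘(ℝ, E') (f ⁻¹' T) x).map
      (mfderiv 𝓘(ℝ, E') 𝓘(ℝ, E'') f x :
        TangentSpace 𝓘(ℝ, E') x →ₗ[ℝ] TangentSpace 𝓘(ℝ, E'') (f x)) := by
    refine tangentTo_le fun c hc hS hc0 c' hc' => ?_
    refine ⟨(show E' from mfderiv 𝓘(ℝ, E'') 𝓘(ℝ, E') σ (f x) (c' 1)), ?_,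
      mfderiv_comp_section hf.contMDiff hσ hσx hfσ _⟩
    have h1 : HasMFDerivAt 𝓘(ℝ, E'') 𝓘(ℝ, E') σ (c 0)
        (show E'' →L[ℝ] E' from mfderiv 𝓘(ℝ, E'') 𝓘(ℝ, E') σ (f x)) := by
      rw [hc0]; exact (hσ.mdifferentiableAt (by simp)).hasMFDerivAt
    have h2 : ContMDiffAt 𝓘(ℝ, E'') 𝓘(ℝ, E') ∞ σ (c 0) := hc0 ▸ hσ
    refine mem_tangentTo_of_hasMFDerivAt (h2.comp 0 hc) ?_ (by simp [hc0, hσx]) (h1.comp 0 hc')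
    have h3 : ∀ᶠ t in 𝓝 (0 : ℝ), f (σ (c t)) = c t := by
      have : Filter.Tendsto c (𝓝 0) (𝓝 (f x)) := hc0 ▸ hc.continuousAt
      exact this.eventually hfσ
    filter_upwards [h3, hS] with t h h'
    simpa [h] using h'
  obtain ⟨b, hb, hbv⟩ := hle hv
  have hker := mem_tangentTo_fiber (hf.isSubmersionAt x) (v := v - b) (by
    rw [map_sub, sub_eq_zero]; exact hbv.symm)
  have hmono : tangentTo 𝓘(ℝ, E') (f ⁻¹' {f x}) x ≤ tangentTo 𝓘(ℝ, E') (f ⁻¹' T) x := by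
    refine tangentTo_le fun c hc hS hc0 c' hc' =>
      mem_tangentTo_of_hasMFDerivAt hc (hS.mono fun t ht => ?_) hc0 hc'
    simp only [Set.mem_preimage, Set.mem_singleton_iff] at ht ⊢
    rwa [ht]
  have := add_mem (hmono hker) hb
  rwa [sub_add_cancel] at this

end Submersion

/-! ### The cotangent lifted action is a smooth action. -/

section CotangentLift

variable {E : Type*} [NormedAddCommGroup E] [NormedSpace ℝ E]
  {Q : Type*} [TopologicalSpace Q] [ChartedSpace E Q] [IsManifold 𝓘(ℝ, E) ∞ Q]
  {G : Type*} [Group G] [MulAction G Q]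

variable (E Q G) in
/-- Every element of `G` acts smoothly on `Q`. -/
def ActsSmoothly : Prop :=
  ∀ g : G, ContMDiff 𝓘(ℝ, E) 𝓘(ℝ, E) ∞ (fun q : Q => g • q)

/-- All tangent spaces are definitionally E. Stated between copies of E, this allows a change of
base point, such as from q to g⁻¹ • g • q, without transport. -/
lemma mfderiv_congr_base (f : Q → Q) {q q' : Q} (h : q = q') :
    (mfderiv 𝓘(ℝ, E) 𝓘(ℝ, E) f q : E →L[ℝ] E) = mfderiv 𝓘(ℝ, E) 𝓘(ℝ, E) f q' := by
  subst h; rfl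

lemma ActsSmoothly.hasMFDerivAt (hG : ActsSmoothly E Q G) (g : G) (q : Q) :
    HasMFDerivAt 𝓘(ℝ, E) 𝓘(ℝ, E) (fun q : Q => g • q) q
      (mfderiv 𝓘(ℝ, E) 𝓘(ℝ, E) (fun q : Q => g • q) q) :=
  ((hG g q).mdifferentiableAt (by simp)).hasMFDerivAt

lemma ActsSmoothly.mfderiv_mul (hG : ActsSmoothly E Q G) (g h : G) (q : Q) :
    (mfderiv 𝓘(ℝ, E) 𝓘(ℝ, E) (fun q : Q => (g * h) • q) q : E →L[ℝ] E) =
      (mfderiv 𝓘(ℝ, E) 𝓘(ℝ, E) (fun q : Q => g • q) (h • q) : E →L[ℝ] E).comp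
        (mfderiv 𝓘(ℝ, E) 𝓘(ℝ, E) (fun q : Q => h • q) q : E →L[ℝ] E) := by
  have h1 := (hG.hasMFDerivAt g (h • q)).comp q (hG.hasMFDerivAt h q)
  have h2 : (fun q : Q => (g * h) • q) = (fun q : Q => g • q) ∘ (fun q : Q => h • q) := by
    funext q; exact mul_smul g h q
  rw [h2]
  exact h1.mfderiv

lemma mfderiv_one_smul (q : Q) :
    (mfderiv 𝓘(ℝ, E) 𝓘(ℝ, E) (fun q : Q => (1 : G) • q) q : E →L[ℝ] E) =
      ContinuousLinearMap.id ℝ E := by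
  have h2 : (fun q : Q => (1 : G) • q) = id := by funext q; exact one_smul G q
  rw [h2]
  exact mfderiv_id

lemma ActsSmoothly.mfderiv_inv_comp (hG : ActsSmoothly E Q G) (g : G) (q : Q) :
    (mfderiv 𝓘(ℝ, E) 𝓘(ℝ, E) (fun q : Q => g⁻¹ • q) (g • q) : E →L[ℝ] E).comp
      (mfderiv 𝓘(ℝ, E) 𝓘(ℝ, E) (fun q : Q => g • q) q : E →L[ℝ] E) =
      ContinuousLinearMap.id ℝ E := by
  rw [← hG.mfderiv_mul, inv_mul_cancel, mfderiv_one_smul]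

lemma ActsSmoothly.mfderiv_comp_inv (hG : ActsSmoothly E Q G) (g : G) (q : Q) :
    (mfderiv 𝓘(ℝ, E) 𝓘(ℝ, E) (fun q : Q => g • q) q : E →L[ℝ] E).comp
      (mfderiv 𝓘(ℝ, E) 𝓘(ℝ, E) (fun q : Q => g⁻¹ • q) (g • q) : E →L[ℝ] E) =
      ContinuousLinearMap.id ℝ E := by
  have := hG.mfderiv_inv_comp g⁻¹ (g • q)
  rw [inv_inv] at this
  exact (congrArg (fun A : E →L[ℝ] E => A.comp _)
    (mfderiv_congr_base _ (inv_smul_smul g q).symm)).trans this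

/-- Turns the formal inverse in `cotLift` into the derivative of g⁻¹, to which the chain rule and
smoothness of derivatives apply. -/
lemma ActsSmoothly.inverse_mfderiv (hG : ActsSmoothly E Q G) (g : G) (q : Q) :
    ContinuousLinearMap.inverse (mfderiv 𝓘(ℝ, E) 𝓘(ℝ, E) (fun q : Q => g • q) q) =
      (show E →L[ℝ] E from mfderiv 𝓘(ℝ, E) 𝓘(ℝ, E) (fun q : Q => g⁻¹ • q) (g • q)) :=
  ContinuousLinearMap.inverse_eq (hG.mfderiv_comp_inv g q) (hG.mfderiv_inv_comp g q)

lemma ActsSmoothly.cotLift_eq (hG : ActsSmoothly E Q G) (g : G) (z : Cot E Q) :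
    cotLift g z = ⟨g • z.proj, (show E →L[ℝ] ℝ from z.2).comp
      (show E →L[ℝ] E from mfderiv 𝓘(ℝ, E) 𝓘(ℝ, E) (fun q : Q => g⁻¹ • q) (g • z.proj))⟩ := by
  rw [cotLift, hG.inverse_mfderiv]
  rfl

lemma cot_ext {q q' : Q} (h : q = q') {p p' : E →L[ℝ] ℝ} (hp : p = p') :
    (⟨q, p⟩ : Cot E Q) = ⟨q', p'⟩ := by
  subst h hp; rfl

lemma ActsSmoothly.cotLift_one (hG : ActsSmoothly E Q G) (z : Cot E Q) :
    cotLift (1 : G) z = z := by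
  rw [hG.cotLift_eq]
  refine cot_ext (E := E) (p' := z.2) (one_smul G _) ?_
  rw [inv_one, mfderiv_one_smul]
  exact ContinuousLinearMap.comp_id _

lemma ActsSmoothly.cotLift_mul (hG : ActsSmoothly E Q G) (g h : G) (z : Cot E Q) :
    cotLift (g * h) z = cotLift g (cotLift h z) := by
  rw [hG.cotLift_eq, hG.cotLift_eq g, hG.cotLift_eq h]
  refine cot_ext (E := E) (mul_smul g h _) ?_
  rw [mul_inv_rev, hG.mfderiv_mul]
  rw [mfderiv_congr_base _ (show g⁻¹ • (g * h) • z.proj = h • z.proj by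
    rw [mul_smul, inv_smul_smul]), mfderiv_congr_base _ (mul_smul g h z.proj)]
  rfl

lemma inCoordinates_congr_target {x₀ x y₀ y y₀' y' : Q} (h₀ : y₀ = y₀') (h : y = y')
    (φ : E →L[ℝ] E) :
    ContinuousLinearMap.inCoordinates E (TangentSpace 𝓘(ℝ, E)) E (TangentSpace 𝓘(ℝ, E))
      x₀ x y₀ y φ =
    ContinuousLinearMap.inCoordinates E (TangentSpace 𝓘(ℝ, E)) E (TangentSpace 𝓘(ℝ, E))
      x₀ x y₀' y' φ := by
  subst h₀ h; rfl

/-- Passing to coordinates respects composition: over the base set, the trivialization inserted in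
the middle cancels against its inverse. -/
lemma inCoordinates_comp_cotangent {x₀ x y₀ y : Q}
    (hx : x ∈ (trivializationAt E (TangentSpace 𝓘(ℝ, E)) x₀).baseSet)
    (p : E →L[ℝ] ℝ) (φ : E →L[ℝ] E) :
    ContinuousLinearMap.inCoordinates E (TangentSpace 𝓘(ℝ, E)) ℝ (Bundle.Trivial Q ℝ)
      y₀ y y₀ y (p.comp φ) =
    (ContinuousLinearMap.inCoordinates E (TangentSpace 𝓘(ℝ, E)) ℝ (Bundle.Trivial Q ℝ)
      x₀ x x₀ x p).comp
    (ContinuousLinearMap.inCoordinates E (TangentSpace 𝓘(ℝ, E)) E (TangentSpace 𝓘(ℝ, E))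
      y₀ y x₀ x φ) := by
  ext v
  simp only [ContinuousLinearMap.inCoordinates, ContinuousLinearMap.comp_apply]
  refine congrArg _ (congrArg p ?_)
  exact (Trivialization.symmL_continuousLinearMapAt (R := ℝ)
    (trivializationAt E (TangentSpace 𝓘(ℝ, E)) x₀) hx _).symm

lemma ActsSmoothly.contMDiff_cotLift (hG : ActsSmoothly E Q G) (g : G) :
    ContMDiff (cotModel E) (cotModel E) ∞ (cotLift g : Cot E Q → Cot E Q) := by
  have hbase : ContMDiff (cotModel E) 𝓘(ℝ, E) ∞ (fun z : Cot E Q => g • z.proj) :=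
    (hG g).comp contMDiff_cotProj
  intro z₀
  rw [show (cotLift g : Cot E Q → Cot E Q) = _ from funext (hG.cotLift_eq g)]
  rw [contMDiffAt_hom_bundle]
  refine ⟨hbase z₀, ?_⟩
  -- In trivializations the lift is the composite of the coordinates of the covector with those of
  -- the derivative of g⁻¹ at g • π z; the latter depend smoothly on z.
  have h1 : ContMDiffAt (cotModel E) 𝓘(ℝ, E →L[ℝ] E) ∞ _ z₀ :=
    ContMDiffAt.mfderiv (I := 𝓘(ℝ, E)) (I' := 𝓘(ℝ, E)) (m := ∞) (n := ∞) (x₀ := z₀)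
    (fun (_ : Cot E Q) (q : Q) => g⁻¹ • q) (fun z : Cot E Q => g • z.proj)
    (((hG g⁻¹).comp contMDiff_snd) _) (hbase z₀) (by simp)
  have h2 := ((contMDiffAt_hom_bundle _).1 (contMDiffAt_id (I := cotModel E) (n := ∞) (x := z₀))).2
  refine (h2.clm_comp h1).congr_of_eventuallyEq ?_
  have h3 : ∀ᶠ z : Cot E Q in 𝓝 z₀,
      z.proj ∈ (trivializationAt E (TangentSpace 𝓘(ℝ, E)) z₀.proj).baseSet :=
    (contMDiff_cotProj (E := E) (Q := Q)).continuous.continuousAt.eventually_mem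
      ((trivializationAt E (TangentSpace 𝓘(ℝ, E)) z₀.proj).open_baseSet.mem_nhds
        (FiberBundle.mem_baseSet_trivializationAt' z₀.proj))
  filter_upwards [h3] with z hz
  refine (inCoordinates_comp_cotangent hz z.2 _).trans (congrArg _ ?_)
  exact inCoordinates_congr_target (inv_smul_smul g z₀.proj).symm (inv_smul_smul g z.proj).symm _

end CotangentLift

/-! ### Legendre transformation and fibre derivative of the Hamiltonian. -/

section FiberDerivative

variable {E : Type*} [NormedAddCommGroup E] [NormedSpace ℝ E]
  {Q : Type*} [TopologicalSpace Q] [ChartedSpace E Q] [IsManifold 𝓘(ℝ, E) ∞ Q]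

lemma trivializationAt_tangent_self (q : Q) (v : E) :
    (trivializationAt E (TangentSpace 𝓘(ℝ, E)) q (⟨q, v⟩ : TangentBundle 𝓘(ℝ, E) Q)).2 = v := by
  have h := (tangentBundleCore 𝓘(ℝ, E) Q).coordChange_self (achart E q) q (mem_chart_source E q) v
  exact h

lemma contMDiff_tangent_fiber (q : Q) :
    ContMDiff 𝓘(ℝ, E) 𝓘(ℝ, E).tangent ∞ (fun v : E => (⟨q, v⟩ : TangentBundle 𝓘(ℝ, E) Q)) := by
  intro v
  rw [contMDiffAt_totalSpace]
  refine ⟨contMDiffAt_const, ?_⟩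
  refine contMDiffAt_id.congr_of_eventuallyEq (Filter.Eventually.of_forall fun v' => ?_)
  exact trivializationAt_tangent_self q v'

lemma contDiff_of_contMDiff_tangent_fiber {V : Type*} [NormedAddCommGroup V] [NormedSpace ℝ V]
    {q : Q} {ψ : V → E}
    (h : ContMDiff 𝓘(ℝ, V) 𝓘(ℝ, E).tangent ∞
      (fun p => (⟨q, ψ p⟩ : TangentBundle 𝓘(ℝ, E) Q))) : ContDiff ℝ ∞ ψ := by
  refine ContMDiff.contDiff fun p => ?_
  have h1 := (contMDiffAt_totalSpace.1 (h p)).2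
  exact h1.congr_of_eventuallyEq
    (Filter.Eventually.of_forall fun p' => (trivializationAt_tangent_self q (ψ p')).symm)

/-- The restriction of a function on `T*Q` to the fibre over `q`. -/
def hamiltonianOn (H : Cot E Q → ℝ) (q : Q) (p : E →L[ℝ] ℝ) : ℝ := H ⟨q, p⟩

lemma contDiff_hamiltonianOn {H : Cot E Q → ℝ} (hH : ContMDiff (cotModel E) 𝓘(ℝ, ℝ) ∞ H) (q : Q) :
    ContDiff ℝ ∞ (hamiltonianOn H q) :=
  (hH.comp (contMDiff_fiber q)).contDiff

namespace System

variable (S : System E Q)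

lemma contDiff_lagrangianOn (q : Q) : ContDiff ℝ ∞ (lagrangianOn S.L q) :=
  (S.smooth_L.comp (contMDiff_tangent_fiber q)).contDiff

lemma contDiff_fderiv_lagrangianOn (q : Q) : ContDiff ℝ ∞ (fderiv ℝ (lagrangianOn S.L q)) :=
  (S.contDiff_lagrangianOn q).fderiv_right (by simp)

/-- The diffeomorphism FL covers the identity of Q, so its inverse restricts to each fibre. -/
lemma exists_legendre_inverse (q : Q) : ∃ ψ : (E →L[ℝ] ℝ) → E, ContDiff ℝ ∞ ψ ∧
    (∀ p, fderiv ℝ (lagrangianOn S.L q) (ψ p) = p) ∧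
    ∀ v, ψ (fderiv ℝ (lagrangianOn S.L q) v) = v := by
  obtain ⟨Φ, hΦ⟩ := S.hyperregular
  have h : ∀ p : E →L[ℝ] ℝ, ∃ v : E,
      Φ.symm (⟨q, p⟩ : Cot E Q) = (⟨q, v⟩ : TangentBundle 𝓘(ℝ, E) Q) := by
    intro p
    obtain ⟨q', v, hv⟩ : ∃ q' v, Φ.symm (⟨q, p⟩ : Cot E Q) = (⟨q', v⟩ : TangentBundle 𝓘(ℝ, E) Q) :=
      ⟨_, _, rfl⟩
    have h1 : legendre S.L ⟨q', v⟩ = (⟨q, p⟩ : Cot E Q) := by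
      rw [← hΦ, ← hv, Φ.apply_symm_apply]
    have h2 : q' = q := congrArg TotalSpace.proj h1
    subst h2
    exact ⟨v, hv⟩
  choose ψ hψ using h
  refine ⟨ψ, ?_, fun p => ?_, fun v => ?_⟩
  · refine contDiff_of_contMDiff_tangent_fiber (q := q) ?_
    have := Φ.symm.contMDiff.comp (contMDiff_fiber (E := E) q)
    rwa [show (Φ.symm ∘ fun p : E →L[ℝ] ℝ => (⟨q, p⟩ : Cot E Q)) = _ from funext hψ] at this
  · have h1 : legendre S.L ⟨q, ψ p⟩ = (⟨q, p⟩ : Cot E Q) := by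
      rw [← hΦ, ← hψ, Φ.apply_symm_apply]
    exact eq_of_heq (TotalSpace.mk.inj h1).2
  · have h1 := hψ (fderiv ℝ (lagrangianOn S.L q) v)
    have h2 : Φ (⟨q, v⟩ : TangentBundle 𝓘(ℝ, E) Q) =
      (⟨q, (fderiv ℝ (lagrangianOn S.L q) v : E →L[ℝ] ℝ)⟩ : Cot E Q) := hΦ _
    rw [← h2, Φ.symm_apply_apply] at h1
    exact (eq_of_heq (TotalSpace.mk.inj h1).2).symm

/-- Differentiate FL ∘ ψ = id on a fibre, where ψ inverts FL. -/
lemma surjective_fiberHessian (q : Q) (v : E) :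
    Function.Surjective (fderiv ℝ (fderiv ℝ (lagrangianOn S.L q)) v) := by
  obtain ⟨ψ, hψ, h1, h2⟩ := S.exists_legendre_inverse q
  have hF := ((S.contDiff_fderiv_lagrangianOn q).differentiable (by simp)
    (ψ (fderiv ℝ (lagrangianOn S.L q) v))).hasFDerivAt.comp _
      (hψ.differentiable (by simp) (fderiv ℝ (lagrangianOn S.L q) v)).hasFDerivAt
  have hid : HasFDerivAt (fderiv ℝ (lagrangianOn S.L q) ∘ ψ)
      (ContinuousLinearMap.id ℝ (E →L[ℝ] ℝ)) (fderiv ℝ (lagrangianOn S.L q) v) :=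
    (hasFDerivAt_id _).congr_of_eventuallyEq (Filter.Eventually.of_forall h1)
  have h3 := hF.unique hid
  rw [h2] at h3
  exact fun β => ⟨_, DFunLike.congr_fun h3 β⟩

/-- The fibre derivative of the Hamiltonian is the inverse of the Legendre transformation. -/
lemma fderiv_hamiltonianOn (q : Q) (v : E) (β : E →L[ℝ] ℝ) :
    fderiv ℝ (hamiltonianOn S.H q) (fderiv ℝ (lagrangianOn S.L q) v) β = β v := by
  -- It suffices to treat directions β = D(FL)(v)w. Differentiating H(FL v) = ⟨FL v, v⟩ - L(v) along
  -- w, the terms ⟨FL v, w⟩ cancel.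
  obtain ⟨w, rfl⟩ := S.surjective_fiberHessian q v β
  set F := fderiv ℝ (lagrangianOn S.L q) with hF
  have hF' := ((S.contDiff_fderiv_lagrangianOn q).differentiable (by simp) v).hasFDerivAt
  have hL := ((S.contDiff_lagrangianOn q).differentiable (by simp) v).hasFDerivAt
  have h1 := ((contDiff_hamiltonianOn S.smooth_H q).differentiable (by simp)
    (F v)).hasFDerivAt.comp v hF'
  have h2 := (hF'.clm_apply (hasFDerivAt_id v)).sub hL
  have h3 : hamiltonianOn S.H q ∘ F = fun v => F v v - lagrangianOn S.L q v :=
    funext fun v => S.hamiltonian_eq ⟨q, v⟩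
  rw [h3] at h1
  have := DFunLike.congr_fun (h1.unique h2) w
  simpa using this

end System

end FiberDerivative

/-! ### Invariance of the constraint submanifold and the vertical part of 𝓚. -/

section Constraint

variable {E : Type*} [NormedAddCommGroup E] [NormedSpace ℝ E]
  {Q : Type*} [TopologicalSpace Q] [ChartedSpace E Q] [IsManifold 𝓘(ℝ, E) ∞ Q]

/-- The constraint submanifold is invariant under the cotangent lifted action. -/
lemma System.cotLift_mem_constraintSet {G : Type*} [Group G] [MulAction G Q]
    (S : System E Q) (hG : ActsSmoothly E Q G)
    (hD : ∀ (g : G) (q : Q), ∀ v ∈ S.D q,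
      mfderiv 𝓘(ℝ, E) 𝓘(ℝ, E) (fun q : Q => g • q) q v ∈ S.D (g • q))
    (hH : ∀ (g : G) (z : Cot E Q), S.H (cotLift g z) = S.H z)
    (g : G) {z : Cot E Q} (hz : z ∈ S.constraintSet) : cotLift g z ∈ S.constraintSet := by
  obtain ⟨q, v, hv, rfl⟩ := hz
  obtain ⟨ψ, -, hψ, -⟩ := S.exists_legendre_inverse (g • q)
  set A : E →L[ℝ] E := mfderiv 𝓘(ℝ, E) 𝓘(ℝ, E) (fun q : Q => g • q) q with hA
  set A' : E →L[ℝ] E := mfderiv 𝓘(ℝ, E) 𝓘(ℝ, E) (fun q : Q => g⁻¹ • q) (g • q) with hA'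
  set p : E →L[ℝ] ℝ := fderiv ℝ (lagrangianOn S.L q) v with hp
  refine ⟨g • q, A v, hD g q v hv, ?_⟩
  have hlift : ∀ r : E →L[ℝ] ℝ, cotLift g (⟨q, r⟩ : Cot E Q) = ⟨g • q, r.comp A'⟩ :=
    fun r => hG.cotLift_eq g _
  have hH' : hamiltonianOn S.H (g • q) ∘ (fun r : E →L[ℝ] ℝ => r.comp A') =
      hamiltonianOn S.H q := by
    funext r
    exact (congrArg S.H (hlift r)).symm.trans (hH g _)
  -- Equivariance of FL. The fibre derivative of H lives in the bidual of E, so the velocities are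
  -- compared by evaluating covectors β on them.
  have hv' : ψ (p.comp A') = A v := by
    have h1 : A' (ψ (p.comp A')) = v := by
      refine (SeparatingDual.eq_iff_forall_dual_eq (R := ℝ)).2 fun β => ?_
      have hc : HasFDerivAt (fun r : E →L[ℝ] ℝ => r.comp A')
          ((ContinuousLinearMap.compL ℝ E E ℝ).flip A') p :=
        ((ContinuousLinearMap.compL ℝ E E ℝ).flip A').hasFDerivAt
      have h2 := ((contDiff_hamiltonianOn S.smooth_H (g • q)).differentiable (by simp)
        (p.comp A')).hasFDerivAt.comp p hc
      rw [hH'] at h2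
      have h3 := DFunLike.congr_fun h2.fderiv β
      have h4 := S.fderiv_hamiltonianOn (g • q) (ψ (p.comp A')) (β.comp A')
      rw [hψ] at h4
      rw [hp, S.fderiv_hamiltonianOn q v β] at h3
      exact (h3.trans h4).symm
    have h5 := DFunLike.congr_fun (hG.mfderiv_comp_inv g q) (ψ (p.comp A'))
    rw [← h1]
    exact h5.symm
  have h6 := hψ (p.comp A')
  rw [hv'] at h6
  refine Eq.trans ?_ (hlift p).symm
  exact cot_ext (E := E) rfl h6

/-- The curve t ↦ FL(v + t w) stays in M, because D_q is linear, and in the fibre over q; its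
velocity is the vertical vector given by the Hessian. -/
lemma System.vertical_mem_distK (S : System E Q) {q : Q} {v w : E} (hv : v ∈ S.D q)
    (hw : w ∈ S.D q) :
    vertical (legendre S.L ⟨q, v⟩) (fderiv ℝ (fderiv ℝ (lagrangianOn S.L q)) v w) ∈
      S.distK (legendre S.L ⟨q, v⟩) := by
  refine ⟨?_, ?_⟩
  · have h0 : dProj (legendre S.L ⟨q, v⟩) (vertical (legendre S.L ⟨q, v⟩)
        (fderiv ℝ (fderiv ℝ (lagrangianOn S.L q)) v w)) = 0 := dProj_vertical _ _
    exact (congrArg (· ∈ S.D q) h0).mpr (zero_mem _)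
  · have hline : HasFDerivAt (fun t : ℝ => v + t • w)
        (ContinuousLinearMap.toSpanSingleton ℝ w) 0 := by
      have := ((hasDerivAt_id (0 : ℝ)).smul_const w).const_add v
      exact (by simpa only [id, one_smul] using this : HasDerivAt _ w (0 : ℝ)).hasFDerivAt
    have h0 : v + (0 : ℝ) • w = v := by simp
    have hF : HasFDerivAt (fderiv ℝ (lagrangianOn S.L q))
        (fderiv ℝ (fderiv ℝ (lagrangianOn S.L q)) v) (v + (0 : ℝ) • w) := by
      rw [h0]
      exact ((S.contDiff_fderiv_lagrangianOn q).differentiable (by simp) v).hasFDerivAt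
    have hc := (hF.comp (0 : ℝ) hline).hasMFDerivAt
    have hι : HasMFDerivAt 𝓘(ℝ, E →L[ℝ] ℝ) (cotModel E)
        (fun p : E →L[ℝ] ℝ => (⟨q, p⟩ : Cot E Q)) (fderiv ℝ (lagrangianOn S.L q) (v + (0 : ℝ) • w))
        (show (E →L[ℝ] ℝ) →L[ℝ] E × (E →L[ℝ] ℝ) from
          mfderiv 𝓘(ℝ, E →L[ℝ] ℝ) (cotModel E) (fun p : E →L[ℝ] ℝ => (⟨q, p⟩ : Cot E Q))
            (fderiv ℝ (lagrangianOn S.L q) v)) := by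
      rw [h0]
      exact ((contMDiff_fiber q _).mdifferentiableAt (by simp)).hasMFDerivAt
    have h1 := hι.comp (0 : ℝ) hc
    have hsm : ContDiff ℝ ∞ (fun t : ℝ => fderiv ℝ (lagrangianOn S.L q) (v + t • w)) :=
      (S.contDiff_fderiv_lagrangianOn q).comp (by fun_prop)
    have h2 := mem_tangentTo_of_hasMFDerivAt (S := S.constraintSet)
      (x := legendre S.L ⟨q, v⟩)
      ((contMDiff_fiber q).comp hsm.contMDiff).contMDiffAt
      (Filter.Eventually.of_forall fun t =>
        ⟨q, v + t • w, add_mem hv ((S.D q).smul_mem t hw), rfl⟩)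
      (congrArg (fun x : E => legendre S.L (⟨q, x⟩ : TangentBundle 𝓘(ℝ, E) Q)) h0) h1
    refine (congrArg (· ∈ tangentTo (cotModel E) S.constraintSet (legendre S.L ⟨q, v⟩)) ?_).mp h2
    exact congrArg (fun x : E => mfderiv 𝓘(ℝ, E →L[ℝ] ℝ) (cotModel E)
      (fun p : E →L[ℝ] ℝ => (⟨q, p⟩ : Cot E Q)) (fderiv ℝ (lagrangianOn S.L q) v)
      (fderiv ℝ (fderiv ℝ (lagrangianOn S.L q)) v x)) (one_smul ℝ w)

end Constraint

/-! ### Vertical vectors, restriction to 𝓚 and one-forms with values in M. -/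

section Restriction

variable {E : Type*} [NormedAddCommGroup E] [NormedSpace ℝ E]
  {Q : Type*} [TopologicalSpace Q] [ChartedSpace E Q] [IsManifold 𝓘(ℝ, E) ∞ Q]

/-- The restriction to `𝓚` of a vertical vector is vertical. -/
lemma System.dProj_eq_zero_of_isRestriction (S : System E Q) {z : Cot E Q}
    (hz : z ∈ S.constraintSet) {b k : TCot z} (hb : dProj z b = 0)
    (h : IsRestriction (canonicalForm z) (S.distK z) b k) : dProj z k = 0 := by
  obtain ⟨q, v, hv, rfl⟩ := hz
  -- D-regularity is applied to the projection of k. Pairing k with the vertical vector Hess(v)w of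
  -- 𝓚 gives Hess(v)(w, Tπ k), which is zero as b is vertical; symmetry of the Hessian puts Tπ k
  -- first.
  refine S.regular q v hv _ h.1.1 fun w hw => ?_
  have h1 := ((canonicalForm_vertical_right _ _ _).symm.trans
    (h.2 _ (S.vertical_mem_distK hv hw))).trans
    (canonicalForm_eq_zero_of_dProj hb (dProj_vertical _ _))
  have h2 : IsSymmSndFDerivAt ℝ (lagrangianOn S.L q) v :=
    (S.contDiff_lagrangianOn q).contDiffAt.isSymmSndFDerivAt (by simpa using ENat.LEInfty.out)
  exact (h2 _ _).trans h1

/-- Vertical lifts stay vertical under τ_𝓚, so force and control are invisible after projection to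
Q. -/
lemma DistributionalSystem.dProj_dynamics {S : System E Q} {A : VerticalPart E Q}
    (K : DistributionalSystem S A) {z : Cot E Q} (hz : z ∈ S.constraintSet) :
    dProj z (K.dynamics z) = dProj z (K.XK z) := by
  rw [DistributionalSystem.dynamics, dProj_add, dProj_add,
    S.dProj_eq_zero_of_isRestriction hz (dProj_vertical _ _) (K.FK_eq z hz),
    S.dProj_eq_zero_of_isRestriction hz (dProj_vertical _ _) (K.uK_eq z hz), add_zero, add_zero]

lemma dProj_mfderiv_formMap {γ : ∀ q : Q, TangentSpace 𝓘(ℝ, E) q →L[ℝ] ℝ}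
    (hγ : ContMDiff 𝓘(ℝ, E) (cotModel E) ∞ (formMap γ)) (q : Q) (v : TangentSpace 𝓘(ℝ, E) q) :
    dProj (formMap γ q) (mfderiv 𝓘(ℝ, E) (cotModel E) (formMap γ) q v) =
      (show TangentSpace 𝓘(ℝ, E) (formMap γ q).proj from v) := by
  have h1 := ((contMDiff_cotProj (E := E) (formMap γ q)).mdifferentiableAt
    (by simp)).hasMFDerivAt.comp q ((hγ q).mdifferentiableAt (by simp)).hasMFDerivAt
  exact DFunLike.congr_fun (hasMFDerivAt_unique h1 (hasMFDerivAt_id q)) v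

lemma System.mfderiv_formMap_mem_distK (S : System E Q)
    {γ : ∀ q : Q, TangentSpace 𝓘(ℝ, E) q →L[ℝ] ℝ}
    (hγ : ContMDiff 𝓘(ℝ, E) (cotModel E) ∞ (formMap γ)) (hγM : ∀ q, formMap γ q ∈ S.constraintSet)
    {q : Q} {v : TangentSpace 𝓘(ℝ, E) q} (hv : v ∈ S.D q) :
    mfderiv 𝓘(ℝ, E) (cotModel E) (formMap γ) q v ∈ S.distK (formMap γ q) := by
  refine ⟨?_, ?_⟩
  · have h0 := dProj_mfderiv_formMap hγ q v
    exact (congrArg (· ∈ S.D q) h0).mpr hv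
  · exact mfderiv_mem_tangentTo (S := Set.univ) (hγ q) (fun q _ => hγM q)
      (by rw [tangentTo_univ]; trivial)

/-- A vector of `𝓚` is determined by its projection to `Q` and by its pairing with the image of `D`
under the tangent map of a one-form with values in the constraint submanifold. -/
lemma DistributionalSystem.eq_of_dProj_eq {S : System E Q} {A : VerticalPart E Q}
    (K : DistributionalSystem S A) {γ : ∀ q : Q, TangentSpace 𝓘(ℝ, E) q →L[ℝ] ℝ}
    (hγ : ContMDiff 𝓘(ℝ, E) (cotModel E) ∞ (formMap γ)) (hγM : ∀ q, formMap γ q ∈ S.constraintSet)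
    {q : Q} {k k' : TCot (formMap γ q)} (hk : k ∈ S.distK (formMap γ q))
    (hk' : k' ∈ S.distK (formMap γ q)) (hp : dProj _ k = dProj _ k')
    (h : ∀ w ∈ S.D q,
      canonicalForm _ k (mfderiv 𝓘(ℝ, E) (cotModel E) (formMap γ) q w) =
        canonicalForm _ k' (mfderiv 𝓘(ℝ, E) (cotModel E) (formMap γ) q w)) :
    k = k' := by
  have hd : dProj _ (k - k') = 0 := by rw [dProj_sub, hp, sub_self]
  refine sub_eq_zero.1 (K.nondegenerate _ (hγM q) _ (sub_mem hk hk') fun a ha => ?_)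
  -- A test vector a of 𝓚 splits as Tγ(w) plus a vertical vector; the latter pairs to zero with the
  -- vertical vector k - k'.
  set w : TangentSpace 𝓘(ℝ, E) q := dProj (formMap γ q) a with hw
  set b : TCot (formMap γ q) := mfderiv 𝓘(ℝ, E) (cotModel E) (formMap γ) q w with hb
  have hab : dProj (formMap γ q) (a - b) = 0 := by
    rw [dProj_sub, sub_eq_zero]
    exact (dProj_mfderiv_formMap hγ q w).symm
  have h1 : a = (a - b) + b := (sub_add_cancel a b).symm
  rw [h1, canonicalForm_add_right, canonicalForm_eq_zero_of_dProj hd hab, canonicalForm_sub_left,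
    h w ha.1, sub_self, add_zero]

end Restriction

/-! ### The isotropy group G_μ and its orbits on J⁻¹(μ). -/

section Isotropy

variable {E : Type*} [NormedAddCommGroup E] [NormedSpace ℝ E]
  {Q : Type*} [TopologicalSpace Q] [ChartedSpace E Q] [IsManifold 𝓘(ℝ, E) ∞ Q]
  {EG : Type*} [NormedAddCommGroup EG] [NormedSpace ℝ EG]
  {G : Type*} [Group G] [TopologicalSpace G] [ChartedSpace EG G]

lemma adjointAction_one : (adjointAction (1 : G) : EG →L[ℝ] EG) = ContinuousLinearMap.id ℝ EG := by
  have h : (fun h : G => 1 * h * (1 : G)⁻¹) = id := by funext h; simp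
  rw [adjointAction, h]
  exact mfderiv_id

lemma adjointAction_mul [LieGroup 𝓘(ℝ, EG) ∞ G] (g h : G) :
    (adjointAction (g * h) : EG →L[ℝ] EG) = (adjointAction g).comp (adjointAction h) := by
  have hc : ∀ g : G, ContMDiff 𝓘(ℝ, EG) 𝓘(ℝ, EG) ∞ (fun x : G => g * x * g⁻¹) := fun g =>
    (contMDiff_mul_right (a := g⁻¹)).comp (contMDiff_mul_left (a := g))
  have h1 : HasMFDerivAt 𝓘(ℝ, EG) 𝓘(ℝ, EG) (fun x : G => g * x * g⁻¹) (h * 1 * h⁻¹)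
      (adjointAction g : EG →L[ℝ] EG) := by
    rw [mul_one, mul_inv_cancel]
    exact ((hc g 1).mdifferentiableAt (by simp)).hasMFDerivAt
  have h2 := h1.comp (1 : G) ((hc h 1).mdifferentiableAt (by simp)).hasMFDerivAt
  have h3 : (fun x : G => (g * h) * x * (g * h)⁻¹) =
      (fun x : G => g * x * g⁻¹) ∘ (fun x : G => h * x * h⁻¹) := by
    funext x; simp [mul_assoc]
  rw [adjointAction, h3]
  exact h2.mfderiv

lemma InIsotropy.one (μ : EG →L[ℝ] ℝ) : InIsotropy μ (1 : G) := by
  rw [InIsotropy, adjointAction_one]; exact ContinuousLinearMap.comp_id μ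

lemma InIsotropy.mul [LieGroup 𝓘(ℝ, EG) ∞ G] {μ : EG →L[ℝ] ℝ} {g h : G} (hg : InIsotropy μ g)
    (hh : InIsotropy μ h) : InIsotropy μ (g * h) := by
  rw [InIsotropy] at *
  rw [adjointAction_mul, ← ContinuousLinearMap.comp_assoc, hg, hh]

lemma InIsotropy.inv [LieGroup 𝓘(ℝ, EG) ∞ G] {μ : EG →L[ℝ] ℝ} {g : G} (hg : InIsotropy μ g) :
    InIsotropy μ g⁻¹ := by
  rw [InIsotropy] at *
  conv_lhs => rw [← hg]
  rw [ContinuousLinearMap.comp_assoc, ← adjointAction_mul, mul_inv_cancel, adjointAction_one]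
  exact ContinuousLinearMap.comp_id μ

/-- The relation defining the quotient is already an equivalence relation, since G_μ is a group and
the lift is an action. -/
lemma ActsSmoothly.reducedProj_eq_iff [MulAction G Q] [LieGroup 𝓘(ℝ, EG) ∞ G]
    (hG : ActsSmoothly E Q G) (J : Cot E Q → (EG →L[ℝ] ℝ)) (μ : EG →L[ℝ] ℝ) (z z' : LevelSet J μ) :
    reducedProj G J μ z = reducedProj G J μ z' ↔
      ∃ g : G, InIsotropy μ g ∧ cotLift g z.1 = z'.1 := by
  refine Quot.eq.trans ⟨fun h => ?_, fun h => Relation.EqvGen.rel _ _ h⟩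
  induction h with
  | rel _ _ h => exact h
  | refl z => exact ⟨1, InIsotropy.one μ, hG.cotLift_one _⟩
  | symm z z' _ ih =>
    obtain ⟨g, hg, h⟩ := ih
    exact ⟨g⁻¹, hg.inv, by rw [← h, ← hG.cotLift_mul, inv_mul_cancel, hG.cotLift_one]⟩
  | trans z z' z'' _ _ ih ih' =>
    obtain ⟨g, hg, h⟩ := ih
    obtain ⟨g', hg', h'⟩ := ih'
    exact ⟨g' * g, hg'.mul hg, by rw [hG.cotLift_mul, h, h']⟩

end Isotropy

/-! ### Lifting 𝓚_μ to 𝓚 ∩ T J⁻¹(μ). -/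

section Lifting

variable {E : Type*} [NormedAddCommGroup E] [NormedSpace ℝ E]
  {Q : Type*} [TopologicalSpace Q] [ChartedSpace E Q] [IsManifold 𝓘(ℝ, E) ∞ Q]
  {EG : Type*} [NormedAddCommGroup EG] [NormedSpace ℝ EG]
  {G : Type*} [Group G] [TopologicalSpace G] [ChartedSpace EG G]
  [LieGroup 𝓘(ℝ, EG) ∞ G] [MulAction G Q]
  {S : System E Q} {J : Cot E Q → (EG →L[ℝ] ℝ)} {μ : EG →L[ℝ] ℝ}
  {ES : Type*} [NormedAddCommGroup ES] [NormedSpace ℝ ES] [ChartedSpace ES (LevelSet J μ)]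
  [IsManifold 𝓘(ℝ, ES) ∞ (LevelSet J μ)]
  {ER : Type*} [NormedAddCommGroup ER] [NormedSpace ℝ ER] [ChartedSpace ER (ReducedSpace G J μ)]
  [IsManifold 𝓘(ℝ, ER) ∞ (ReducedSpace G J μ)]

lemma IsReducedStructure.hasMFDerivAt_incl (hR : IsReducedStructure G J μ ES ER)
    (z : LevelSet J μ) : HasMFDerivAt 𝓘(ℝ, ES) (cotModel E)
      (Subtype.val : LevelSet J μ → Cot E Q) z (dIncl J μ ES z) :=
  ((hR.embedding.contMDiff z).mdifferentiableAt (by simp)).hasMFDerivAt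

lemma IsReducedStructure.hasMFDerivAt_red (hR : IsReducedStructure G J μ ES ER)
    (z : LevelSet J μ) : HasMFDerivAt 𝓘(ℝ, ES) 𝓘(ℝ, ER) (reducedProj G J μ) z
      (dRed G J μ ES ER z) :=
  ((hR.submersion.contMDiff z).mdifferentiableAt (by simp)).hasMFDerivAt

/-- A smooth map into `T*Q` with values in `J⁻¹(μ)` is smooth as a map into `J⁻¹(μ)`. -/
lemma IsReducedStructure.contMDiff_codRestrict (hR : IsReducedStructure G J μ ES ER)
    {V : Type*} [NormedAddCommGroup V] [NormedSpace ℝ V] {P : Type*} [TopologicalSpace P]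
    [ChartedSpace V P] {f : P → LevelSet J μ}
    (hf : ContMDiff 𝓘(ℝ, V) (cotModel E) ∞ (fun x => (f x).1)) :
    ContMDiff 𝓘(ℝ, V) 𝓘(ℝ, ES) ∞ f :=
  (ContMDiff.iff_comp_isImmersion hR.embedding.isImmersion).2
    ⟨hf.continuous.subtype_mk fun x => (f x).2, hf⟩

/-- The differential of `π_μ` at `y` on `𝓕 ∩ T J⁻¹(μ)` has the same image at every point of the
`G_μ`-orbit. -/
lemma IsReducedStructure.exists_lift_distF (hR : IsReducedStructure G J μ ES ER)
    (hG : ActsSmoothly E Q G) (hS : IsPointReducible G S J μ) {z y : LevelSet J μ}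
    (hzy : reducedProj G J μ z = reducedProj G J μ y)
    {v : TangentSpace 𝓘(ℝ, ES) z} (hv : dIncl J μ ES z v ∈ S.distF z.1) :
    ∃ a : TangentSpace 𝓘(ℝ, ES) y, dIncl J μ ES y a ∈ S.distF y.1 ∧
      (show ER from dRed G J μ ES ER y a) = dRed G J μ ES ER z v := by
  obtain ⟨g, hg, h⟩ := (hG.reducedProj_eq_iff J μ z y).1 hzy
  -- Translation by g on the level set. Vectors are moved by Tφ: π_Q intertwines φ with g, so
  -- invariance of D preserves 𝓕, while π_μ ∘ φ = π_μ keeps the image unchanged.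
  set φ : LevelSet J μ → LevelSet J μ := fun w => ⟨cotLift g w.1, by
    rw [hS.momentum.equivariant, w.2]; exact hg.inv⟩ with hφ
  obtain rfl : φ z = y := Subtype.ext h
  have hφs : ContMDiff 𝓘(ℝ, ES) 𝓘(ℝ, ES) ∞ φ :=
    hR.contMDiff_codRestrict ((hG.contMDiff_cotLift g).comp hR.embedding.contMDiff)
  have hφ' := ((hφs z).mdifferentiableAt (by simp)).hasMFDerivAt
  refine ⟨mfderiv 𝓘(ℝ, ES) 𝓘(ℝ, ES) φ z v, ?_, ?_⟩
  · have hπ := fun z : Cot E Q => ((contMDiff_cotProj z).mdifferentiableAt (by simp)).hasMFDerivAt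
    have h1 := (hπ (φ z).1).comp z ((hR.hasMFDerivAt_incl (φ z)).comp z hφ')
    have h2 := (hG.hasMFDerivAt g z.1.proj).comp z
      ((hπ z.1).comp z (hR.hasMFDerivAt_incl z))
    have h3 := DFunLike.congr_fun (hasMFDerivAt_unique h1 h2) v
    exact (congrArg (· ∈ S.D (g • z.1.proj)) h3).mpr (hS.D_invariant g _ _ hv)
  · have h1 := (hR.hasMFDerivAt_red (φ z)).comp z hφ'
    have h2 : HasMFDerivAt 𝓘(ℝ, ES) 𝓘(ℝ, ER) (reducedProj G J μ ∘ φ) z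
        (dRed G J μ ES ER z : ES →L[ℝ] ER) := by
      have : reducedProj G J μ ∘ φ = reducedProj G J μ :=
        funext fun w => ((hG.reducedProj_eq_iff J μ w (φ w)).2 ⟨g, hg, rfl⟩).symm
      rw [this]; exact hR.hasMFDerivAt_red z
    exact DFunLike.congr_fun (hasMFDerivAt_unique h1 h2) v

/-- Every vector of `𝓚_μ` is the image under `Tπ_μ` of a vector of `𝓚 ∩ T J⁻¹(μ)`. -/
lemma IsReducedStructure.exists_lift_reducedK (hR : IsReducedStructure G J μ ES ER)
    (hG : ActsSmoothly E Q G) (hS : IsPointReducible G S J μ) {y : LevelSet J μ}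
    (hy : y.1 ∈ S.constraintSet) {w : TangentSpace 𝓘(ℝ, ER) (reducedProj G J μ y)}
    (hw : w ∈ reducedK G S J μ ES ER (reducedProj G J μ y)) :
    ∃ a : TangentSpace 𝓘(ℝ, ES) y, dIncl J μ ES y a ∈ S.distK y.1 ∧
      dRed G J μ ES ER y a = w := by
  -- The span defining 𝓕_μ ranges over all points of the orbit; every generator is moved to the
  -- chosen point y.
  have hle : reducedF G S J μ ES ER (reducedProj G J μ y) ≤
      ((S.distF y.1).comap (dIncl J μ ES y : TangentSpace 𝓘(ℝ, ES) y →ₗ[ℝ] TCot y.1)).map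
        (dRed G J μ ES ER y :
          TangentSpace 𝓘(ℝ, ES) y →ₗ[ℝ] TangentSpace 𝓘(ℝ, ER) (reducedProj G J μ y)) := by
    refine Submodule.span_le.2 ?_
    rintro w' ⟨z, v, hv, hzv⟩
    obtain ⟨h1, h2⟩ := TotalSpace.mk.inj hzv
    obtain ⟨a, ha, haw⟩ := hR.exists_lift_distF hG hS h1 hv
    exact ⟨a, ha, haw.trans (eq_of_heq h2)⟩
  obtain ⟨a, ha, rfl⟩ := hle hw.1
  refine ⟨a, ⟨ha, ?_⟩, rfl⟩
  -- The lift a is tangent to π_μ⁻¹(M_μ), and that set lies in M because M is G-invariant.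
  have h1 := tangentTo_preimage hR.submersion (x := y) (T := reducedConstraintSet G S J μ)
    ⟨y, hy, rfl⟩ hw.2
  refine mfderiv_mem_tangentTo (hR.embedding.contMDiff y) (fun z hz => ?_) h1
  obtain ⟨z', hz', h⟩ := hz
  obtain ⟨g, -, hg⟩ := (hG.reducedProj_eq_iff J μ z' z).1 h
  rw [← hg]
  exact S.cotLift_mem_constraintSet hG hS.D_invariant hS.H_invariant g hz'

lemma ReducedDistributionalSystem.mfderiv_h {A : VerticalPart E Q} {K : DistributionalSystem S A}
    (hR : IsReducedStructure G J μ ES ER) (R : ReducedDistributionalSystem G J μ ES ER K)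
    (y : LevelSet J μ) (a : TangentSpace 𝓘(ℝ, ES) y) :
    mfderiv 𝓘(ℝ, ER) 𝓘(ℝ, ℝ) R.h (reducedProj G J μ y) (dRed G J μ ES ER y a) =
      dFun S.H y.1 (dIncl J μ ES y a) := by
  have h1 := ((R.smooth_h (reducedProj G J μ y)).mdifferentiableAt (by simp)).hasMFDerivAt.comp y
    (hR.hasMFDerivAt_red y)
  have h2 := ((S.smooth_H y.1).mdifferentiableAt (by simp)).hasMFDerivAt.comp y
    (hR.hasMFDerivAt_incl y)
  rw [show R.h ∘ reducedProj G J μ = S.H ∘ Subtype.val from funext R.h_eq] at h1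
  exact DFunLike.congr_fun (hasMFDerivAt_unique h1 h2) a

end Lifting

/-! ### Equivalence of the two Hamilton–Jacobi equations. -/

section HamiltonJacobi

variable {E : Type*} [NormedAddCommGroup E] [NormedSpace ℝ E]
  {Q : Type*} [TopologicalSpace Q] [ChartedSpace E Q] [IsManifold 𝓘(ℝ, E) ∞ Q]
  {EG : Type*} [NormedAddCommGroup EG] [NormedSpace ℝ EG]
  {G : Type*} [Group G] [TopologicalSpace G] [ChartedSpace EG G]
  [LieGroup 𝓘(ℝ, EG) ∞ G] [MulAction G Q]
  {S : System E Q} {J : Cot E Q → (EG →L[ℝ] ℝ)} {μ : EG →L[ℝ] ℝ}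
  {ES : Type*} [NormedAddCommGroup ES] [NormedSpace ℝ ES] [ChartedSpace ES (LevelSet J μ)]
  [IsManifold 𝓘(ℝ, ES) ∞ (LevelSet J μ)]
  {ER : Type*} [NormedAddCommGroup ER] [NormedSpace ℝ ER] [ChartedSpace ER (ReducedSpace G J μ)]
  [IsManifold 𝓘(ℝ, ER) ∞ (ReducedSpace G J μ)]
  {A : VerticalPart E Q} {K : DistributionalSystem S A}
  {γ : ∀ q : Q, TangentSpace 𝓘(ℝ, E) q →L[ℝ] ℝ}

/-- The equivalence of the two Hamilton–Jacobi equations over a point `q`. -/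
lemma mfderiv_formMap_eq_XK_iff (hR : IsReducedStructure G J μ ES ER)
    (hG : ActsSmoothly E Q G) (hS : IsPointReducible G S J μ)
    (R : ReducedDistributionalSystem G J μ ES ER K)
    (hγ : ContMDiff 𝓘(ℝ, E) (cotModel E) ∞ (formMap γ))
    (hγM : ∀ q, formMap γ q ∈ S.constraintSet) (hγJ : ∀ q, J (formMap γ q) = μ)
    (hγK : ∀ (q : Q) (v : TangentSpace 𝓘(ℝ, E) q),
      mfderiv 𝓘(ℝ, E) 𝓘(ℝ, ER) (fun q => reducedProj G J μ ⟨formMap γ q, hγJ q⟩) q v ∈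
        reducedK G S J μ ES ER (reducedProj G J μ ⟨formMap γ q, hγJ q⟩))
    (q : Q) :
    mfderiv 𝓘(ℝ, E) (cotModel E) (formMap γ) q
        (dProj (formMap γ q) (K.XK (formMap γ q))) = K.XK (formMap γ q) ↔
      mfderiv 𝓘(ℝ, E) 𝓘(ℝ, ER) (fun q => reducedProj G J μ ⟨formMap γ q, hγJ q⟩) q
        (dProj (formMap γ q) (K.XK (formMap γ q))) =
        R.XK (reducedProj G J μ ⟨formMap γ q, hγJ q⟩) := by
  set v : TangentSpace 𝓘(ℝ, E) q := dProj (formMap γ q) (K.XK (formMap γ q)) with hv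
  have hvD : v ∈ S.D q := (K.XK_mem _ (hγM q)).1
  -- Factoring γ through J⁻¹(μ) expresses Tγ and Tγ̄_μ as Ti_μ and Tπ_μ of one vector T w, so that
  -- π_μ^*ω_μ = i_μ^*ω compares them.
  set γ' : Q → LevelSet J μ := fun q => ⟨formMap γ q, hγJ q⟩ with hγ'
  set y : LevelSet J μ := γ' q with hy
  have hγs : ContMDiff 𝓘(ℝ, E) 𝓘(ℝ, ES) ∞ γ' := hR.contMDiff_codRestrict hγ
  set T : E →L[ℝ] ES := mfderiv 𝓘(ℝ, E) 𝓘(ℝ, ES) γ' q with hT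
  have hγd : HasMFDerivAt 𝓘(ℝ, E) 𝓘(ℝ, ES) γ' q T :=
    ((hγs q).mdifferentiableAt (by simp)).hasMFDerivAt
  have hincl : ∀ w : TangentSpace 𝓘(ℝ, E) q,
      mfderiv 𝓘(ℝ, E) (cotModel E) (formMap γ) q w = dIncl J μ ES y (T w) := fun w =>
    DFunLike.congr_fun ((hR.hasMFDerivAt_incl y).comp q hγd).mfderiv w
  have hred : ∀ w : TangentSpace 𝓘(ℝ, E) q,
      mfderiv 𝓘(ℝ, E) 𝓘(ℝ, ER) (fun q => reducedProj G J μ (γ' q)) q w =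
        dRed G J μ ES ER y (T w) := fun w =>
    DFunLike.congr_fun ((hR.hasMFDerivAt_red y).comp q hγd).mfderiv w
  have hmem : reducedProj G J μ y ∈ reducedConstraintSet G S J μ := ⟨y, hγM q, rfl⟩
  have hTK : ∀ w, dRed G J μ ES ER y (T w) ∈ reducedK G S J μ ES ER (reducedProj G J μ y) :=
    fun w => hred w ▸ hγK q w
  rw [hincl, hred]
  constructor
  · intro h
    refine sub_eq_zero.1 (R.nondegenerate _ hmem _ (sub_mem (hTK v) (R.XK_mem _ hmem))
      fun w hw => ?_)
    obtain ⟨a, ha, rfl⟩ := hR.exists_lift_reducedK hG hS (hγM q) hw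
    -- ω_μ(Tγ̄_μ v, Tπ_μ a) = ω(X_𝓚, a) = dH(a) = dh_μ(Tπ_μ a) = ω_μ(X_{𝓚_μ}, Tπ_μ a).
    have h1 := (((R.form_eq y (T v) a).trans
      (congrArg (fun x => canonicalForm y.1 x (dIncl J μ ES y a)) h)).trans
      (K.XK_eq _ (hγM q) _ ha)).trans ((R.mfderiv_h hR y a).symm.trans (R.XK_eq _ hmem _ hw).symm)
    simp only [map_sub]
    exact sub_eq_zero.2 h1
  · intro h
    refine K.eq_of_dProj_eq hγ hγM (hincl v ▸ S.mfderiv_formMap_mem_distK hγ hγM hvD)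
      (K.XK_mem _ (hγM q)) ?_ fun w hw => ?_
    · rw [← hincl]; exact dProj_mfderiv_formMap hγ q v
    · rw [K.XK_eq _ (hγM q) _ (S.mfderiv_formMap_mem_distK hγ hγM hw), hincl]
      -- The same chain tested on Tγ w: as Tγ̄_μ w lies in 𝓚_μ, the equation defining X_{𝓚_μ}
      -- applies to it.
      exact (((R.form_eq y (T v) (T w)).symm.trans
        (congrArg (fun x => R.form _ x (dRed G J μ ES ER y (T w))) h)).trans
        (R.XK_eq _ hmem _ (hTK w))).trans (R.mfderiv_h hR y (T w))

/-- The equivalence of the two Hamilton–Jacobi equations at a point of `J⁻¹(μ)`. -/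
lemma hamiltonJacobi_iff_reduced (hR : IsReducedStructure G J μ ES ER)
    (hG : ActsSmoothly E Q G) (hS : IsPointReducible G S J μ)
    (R : ReducedDistributionalSystem G J μ ES ER K)
    (hγ : ContMDiff 𝓘(ℝ, E) (cotModel E) ∞ (formMap γ))
    (hγM : ∀ q, formMap γ q ∈ S.constraintSet) (hγJ : ∀ q, J (formMap γ q) = μ)
    (hγK : ∀ (q : Q) (v : TangentSpace 𝓘(ℝ, E) q),
      mfderiv 𝓘(ℝ, E) 𝓘(ℝ, ER) (fun q => reducedProj G J μ ⟨formMap γ q, hγJ q⟩) q v ∈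
        reducedK G S J μ ES ER (reducedProj G J μ ⟨formMap γ q, hγJ q⟩))
    (y : Cot E Q) (hyJ : J y = μ) :
    tangentMap 𝓘(ℝ, E) (cotModel E) (formMap γ) ⟨y.proj, dProj y (K.XK y)⟩ =
        (⟨y, K.XK y⟩ : TangentBundle (cotModel E) (Cot E Q)) ↔
      tangentMap 𝓘(ℝ, E) 𝓘(ℝ, ER) (fun q => reducedProj G J μ ⟨formMap γ q, hγJ q⟩)
          ⟨y.proj, dProj y (K.XK y)⟩ =
        (⟨reducedProj G J μ ⟨y, hyJ⟩, R.XK (reducedProj G J μ ⟨y, hyJ⟩)⟩ :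
          TangentBundle 𝓘(ℝ, ER) (ReducedSpace G J μ)) := by
  by_cases hy : formMap γ y.proj = y
  · obtain ⟨q, rfl⟩ : ∃ q, formMap γ q = y := ⟨_, hy⟩
    exact (TotalSpace.mk_inj.trans (mfderiv_formMap_eq_XK_iff hR hG hS R hγ hγM hγJ hγK q)).trans TotalSpace.mk_inj.symm
  -- Off the image of γ both sides fail at the level of base points: a group element taking γ(π y)
  -- to y fixes π y, so it is 1 by freeness.
  · refine iff_of_false (fun h => hy (congrArg TotalSpace.proj h)) fun h => hy ?_
    obtain ⟨g, -, hg⟩ := (hG.reducedProj_eq_iff J μ _ _).1 (congrArg TotalSpace.proj h)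
    have hg1 : g = 1 := hS.free g _ (congrArg TotalSpace.proj hg)
    subst hg1
    exact (hG.cotLift_one _).symm.trans hg

end HamiltonJacobi

end NonholonomicRCH

open NonholonomicRCH in
theorem theorem5p5
    {E : Type*} [NormedAddCommGroup E] [NormedSpace ℝ E] [FiniteDimensional ℝ E]
    {Q : Type*} [TopologicalSpace Q] [T2Space Q] [SecondCountableTopology Q]
    [ChartedSpace E Q] [IsManifold 𝓘(ℝ, E) ∞ Q]
    {EG : Type*} [NormedAddCommGroup EG] [NormedSpace ℝ EG] [FiniteDimensional ℝ EG]
    {G : Type*} [Group G] [TopologicalSpace G] [T2Space G] [SecondCountableTopology G]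
    [ChartedSpace EG G] [LieGroup 𝓘(ℝ, EG) ∞ G]
    [MulAction G Q] [ContMDiffSMul 𝓘(ℝ, EG) 𝓘(ℝ, E) ∞ G Q] [ProperSMul G Q]
    (S : System E Q) (A : VerticalPart E Q)
    (J : Cot E Q → (EG →L[ℝ] ℝ)) (μ : EG →L[ℝ] ℝ)
    (hS : IsPointReducible G S J μ)
    (K : DistributionalSystem S A)
    {ES : Type*} [NormedAddCommGroup ES] [NormedSpace ℝ ES] [FiniteDimensional ℝ ES]
    [ChartedSpace ES (LevelSet J μ)] [IsManifold 𝓘(ℝ, ES) ∞ (LevelSet J μ)]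
    {ER : Type*} [NormedAddCommGroup ER] [NormedSpace ℝ ER] [FiniteDimensional ℝ ER]
    [ChartedSpace ER (ReducedSpace G J μ)] [IsManifold 𝓘(ℝ, ER) ∞ (ReducedSpace G J μ)]
    (hR : IsReducedStructure G J μ ES ER)
    (R : ReducedDistributionalSystem G J μ ES ER K)
    (γ : ∀ q : Q, TangentSpace 𝓘(ℝ, E) q →L[ℝ] ℝ)
    (hγ : ContMDiff 𝓘(ℝ, E) (cotModel E) ∞ (formMap γ))
    (hγM : ∀ q, formMap γ q ∈ S.constraintSet)
    (hγJ : ∀ q, J (formMap γ q) = μ)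
    (hγG : ∀ g : G, InIsotropy μ g → ∀ q, formMap γ (g • q) = cotLift g (formMap γ q))
    (hγK : ∀ (q : Q) (v : TangentSpace 𝓘(ℝ, E) q),
      mfderiv 𝓘(ℝ, E) 𝓘(ℝ, ER) (fun q => reducedProj G J μ ⟨formMap γ q, hγJ q⟩) q v ∈
        reducedK G S J μ ES ER (reducedProj G J μ ⟨formMap γ q, hγJ q⟩))
    (ε : Cot E Q → Cot E Q)
    (hε : IsSymplecticMap ε)
    (hεG : ∀ g : G, InIsotropy μ g → ∀ z, ε (cotLift g z) = cotLift g (ε z))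
    (hεM : ∀ z ∈ S.constraintSet, J z = μ → ε z ∈ S.constraintSet)
    (hεJ : ∀ z ∈ S.constraintSet, J z = μ → J (ε z) = μ) :
    (∀ z ∈ S.constraintSet, J z = μ →
      tangentMap 𝓘(ℝ, E) (cotModel E) (formMap γ) (K.dynamicsAlong ε z) =
        (⟨ε z, K.XK (ε z)⟩ : TangentBundle (cotModel E) (Cot E Q))) ↔
    (∀ z (hz : z ∈ S.constraintSet) (hzJ : J z = μ),
      tangentMap 𝓘(ℝ, E) 𝓘(ℝ, ER) (fun q => reducedProj G J μ ⟨formMap γ q, hγJ q⟩)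
          (K.dynamicsAlong ε z) =
        (⟨reducedProj G J μ ⟨ε z, hεJ z hz hzJ⟩, R.XK (reducedProj G J μ ⟨ε z, hεJ z hz hzJ⟩)⟩ :
          TangentBundle 𝓘(ℝ, ER) (ReducedSpace G J μ))) := by
  have hG : ActsSmoothly E Q G := fun g =>
    (ContMDiffSMul.contMDiff_smul (I := 𝓘(ℝ, EG)) (I' := 𝓘(ℝ, E)) (n := ∞) (G := G) (M := Q)).comp
      (contMDiff_const.prodMk contMDiff_id)
  have hdyn : ∀ z ∈ S.constraintSet, J z = μ → K.dynamicsAlong ε z =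
      ⟨(ε z).proj, dProj (ε z) (K.XK (ε z))⟩ := fun z hz hzJ => by
    rw [DistributionalSystem.dynamicsAlong, K.dProj_dynamics (hεM z hz hzJ)]
  refine forall_congr' fun z => forall_congr' fun hz => forall_congr' fun hzJ => ?_
  rw [hdyn z hz hzJ]
  exact hamiltonJacobi_iff_reduced hR hG hS R hγ hγM hγJ hγK (ε z) (hεJ z hz hzJ)
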